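/- Let $p$ be a prime, $K$ a complete discrete valuation field of mixed characteristic $(0,p)$ with perfect residue field $k$, $\overline K$ an algebraic closure, $G=\mathrm{Gal}(\overline K/K)$, $v_p$ the valuation of $\overline K$ with $v_p(p)=1$, and $e$ the absolute ramification index of $K$. Let $f(u)=u^p+a_{p-1}u^{p-1}+\cdots+a_1u\in\mathbb Z_p[u]$ with $f\equiv u^p \bmod p$, let $\pi_0=\pi$ be a uniformizer of $K$, let $\pi_n\in\overline K$ satisfy $f(\pi_{n+1})=\pi_n$ for all $n\ge 0$, and put $G_{\underline\pi}=\mathrm{Gal}(\overline K/K_{\underline\pi})$ with $K_{\underline\pi}=\bigcup_{n}K(\pi_n)$. Let $R=\varprojlim \mathcal O_{\overline K}/p$ (transition maps $x\mapsto x^p$), with its natural $G$-action and with the valuation $v_R(x)=\lim_n v_p(\hat x_n^{\,p^n})$ for lifts $\hat x_n$ of the components of $x$, and put $\mathfrak m_R^{\ge c}=\{x\in R: v_R(x)\ge c\}$. Let $\underline\pi=(\pi_n \bmod p)_n\in R$, and let $\{\underline\pi\}_f\in W(R)$ be the unique lift of $\underline\pi$ with $\varphi(\{\underline\pi\}_f)=f(\{\underline\pi\}_f)$.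 Regard $\mathfrak S=W(k)[[u]]$ as a subring of $W(R)$ via the canonical map $W(k)\to W(R)$ and $u\mapsto\{\underline\pi\}_f$; it is $\varphi$-stable, and $\varphi(u)=f(u)$ on $\mathfrak S$. Let $r\ge 0$ and $d\ge 1$ be integers, and let $\mathfrak n=(n_i)_{i\in\mathbb Z/d\mathbb Z}$ be a sequence of integers $0\le n_i\le er$ with smallest period $d$. Let $\mathfrak M(\mathfrak n)=\bigoplus_{i\in\mathbb Z/d\mathbb Z}k[[u]]\,e_i$ be the $\mathfrak S$-module (killed by $p$) with the $\varphi$-semilinear map $\varphi$ given by $\varphi(e_i)=u^{n_i}e_{i+1}$. **Theorem.** Assume that $v_p(a_i)>1$ for $1\le i\le p-1$. Then there exists a $W(R)$-semilinear $G$-action on $W(R)\otimes_{\varphi,\mathfrak S}\mathfrak M(\mathfrak n)$ such that 1. the action commutes with $\varphi_{W(R)}\otimes\varphi_{\mathfrak M(\mathfrak n)}$; 2. $G_{\underline\pi}$ acts trivially on (the image of) $\mathfrak S\otimes_{\varphi,\mathfrak S}\mathfrak M(\mathfrak n)$; 3. $g(1\otimes x)-1\otimes x\in \mathfrak m_R^{\ge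 p^2/(p-1)}\otimes_{\varphi,\mathfrak S}\mathfrak M(\mathfrak n)$ for all $g\in G$ and $x\in\mathfrak M(\mathfrak n)$, where $W(R)\otimes_{\varphi,\mathfrak S}\mathfrak M(\mathfrak n)$ is identified with $R\otimes_{\varphi,\mathfrak S}\mathfrak M(\mathfrak n)$. Moreover, if $0\le n_i\le\min\{er,p-1\}$ for all $i$, then the $G$-action with these properties is unique. -/

import Mathlib

set_option linter.unusedSectionVars false

noncomputable section
namespace IterKisin
open PowerSeries TensorProduct

section Eval
variable {B A : Type*} [CommRing B] [CommRing A]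

/-- `A` is complete and separated for the linear topology defined by the decreasing ideals `J n`. -/
structure IsComplSystem (J : ℕ → Ideal A) : Prop where
  sep : ∀ x, (∀ n, x ∈ J n) → x = 0
  compl : ∀ s : ℕ → A, (∀ n, s (n + 1) - s n ∈ J n) → ∃ y, ∀ n, y - s n ∈ J n
  anti : ∀ n, J (n + 1) ≤ J n

variable {J : ℕ → Ideal A}

theorem map_sub_trunc_mem (I : Ideal A) (F : B⟦X⟧ →+* A) (g : B⟦X⟧) (M : ℕ)
    (hM : F X ^ M ∈ I) :
    F g - (trunc M g).eval₂ (F.comp (C (R := B))) (F X) ∈ I := by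
  have h1 : ∀ q : Polynomial B, F (q : B⟦X⟧) = q.eval₂ (F.comp (C (R := B))) (F X) := by
    intro q
    have : F.comp (Polynomial.coeToPowerSeries.ringHom (R := B))
        = Polynomial.eval₂RingHom (F.comp (C (R := B))) (F X) := by
      apply Polynomial.ringHom_ext <;> intros <;> simp
    exact congrArg (fun h : Polynomial B →+* A => h q) this
  rw [← h1, ← map_sub]
  have h2 : g - (trunc M g : B⟦X⟧) = X ^ M * mk fun i => coeff (i + M) g := by
    rw [sub_eq_iff_eq_add]; exact eq_X_pow_mul_shift_add_trunc M g
  rw [h2, map_mul, map_pow]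
  exact I.mul_mem_right _ hM

/-- Two ring homomorphisms out of `B⟦X⟧` that agree on constants and on `X`, with topologically
nilpotent value at `X`, are equal. -/
theorem powerSeries_hom_ext (sep : ∀ x, (∀ n, x ∈ J n) → x = 0) (F G : B⟦X⟧ →+* A)
    (hC : ∀ a, F (C a) = G (C a)) (hX : F X = G X) (hb : ∀ n, ∃ M, F X ^ M ∈ J n) : F = G := by
  ext1 g
  rw [← sub_eq_zero]
  refine sep _ fun n => ?_
  obtain ⟨M, hM⟩ := hb n
  have h1 := map_sub_trunc_mem (J n) F g M hM
  have h2 := map_sub_trunc_mem (J n) G g M (hX ▸ hM)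
  have hc : F.comp (C (R := B)) = G.comp C := RingHom.ext hC
  rw [← hX, ← hc] at h2
  simpa using (J n).sub_mem h1 h2

theorem eval_trunc_sub_mem (I : Ideal A) (c : B →+* A) (b : A) {M N : ℕ} (hM : b ^ M ∈ I)
    (hN : b ^ N ∈ I) (g : B⟦X⟧) :
    (trunc N g).eval₂ c b - (trunc M g).eval₂ c b ∈ I := by
  wlog h : M ≤ N generalizing M N
  · have := I.neg_mem (this hN hM (le_of_not_ge h))
    simpa using this
  obtain ⟨k, rfl⟩ := Nat.exists_eq_add_of_le h
  rw [eval₂_trunc_eq_sum_range, eval₂_trunc_eq_sum_range, Finset.sum_range_add, add_sub_cancel_left]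
  refine I.sum_mem fun i _ => ?_
  rw [pow_add]
  exact I.mul_mem_left _ (I.mul_mem_right _ hM)

theorem exists_eval (hJ : IsComplSystem J) (c : B →+* A) (b : A) (hb : ∀ n, ∃ M, b ^ M ∈ J n)
    (g : B⟦X⟧) :
    ∃ y : A, ∀ n M, b ^ M ∈ J n → y - (trunc M g).eval₂ c b ∈ J n := by
  choose M hM using hb
  obtain ⟨y, hy⟩ := hJ.compl (fun n => (trunc (M n) g).eval₂ c b) fun n =>
    eval_trunc_sub_mem (J n) c b (hM n) (hJ.anti n (hM (n + 1))) g
  refine ⟨y, fun n N hN => ?_⟩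
  have := (J n).add_mem (hy n) (eval_trunc_sub_mem (J n) c b hN (hM n) g)
  simpa using this

/-- Evaluation `g = ∑ aᵢ Xⁱ ↦ ∑ c(aᵢ) bⁱ` of power series at a topologically nilpotent
element `b`. -/
def evalHom (hJ : IsComplSystem J) (c : B →+* A) (b : A) (hb : ∀ n, ∃ M, b ^ M ∈ J n) :
    B⟦X⟧ →+* A where
  toFun g := (exists_eval hJ c b hb g).choose
  map_zero' := by
    refine hJ.sep _ fun n => ?_
    obtain ⟨M, hM⟩ := hb n
    simpa using (exists_eval hJ c b hb 0).choose_spec n M hM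
  map_one' := by
    rw [← sub_eq_zero]
    refine hJ.sep _ fun n => ?_
    obtain ⟨M, hM⟩ := hb n
    have := (exists_eval hJ c b hb 1).choose_spec n (M + 1)
      (by rw [pow_succ]; exact (J n).mul_mem_right _ hM)
    simpa using this
  map_add' g h := by
    rw [← sub_eq_zero]
    refine hJ.sep _ fun n => ?_
    obtain ⟨M, hM⟩ := hb n
    have h1 := (exists_eval hJ c b hb g).choose_spec n M hM
    have h2 := (exists_eval hJ c b hb h).choose_spec n M hM
    have h3 := (exists_eval hJ c b hb (g + h)).choose_spec n M hM
    have := (J n).sub_mem h3 ((J n).add_mem h1 h2)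
    rw [map_add, Polynomial.eval₂_add] at this
    convert this using 1
    ring
  map_mul' g h := by
    rw [← sub_eq_zero]
    refine hJ.sep _ fun n => ?_
    obtain ⟨M, hM⟩ := hb n
    have h1 := (exists_eval hJ c b hb g).choose_spec n M hM
    have h2 := (exists_eval hJ c b hb h).choose_spec n M hM
    have h3 := (exists_eval hJ c b hb (g * h)).choose_spec n M hM
    set y := (exists_eval hJ c b hb g).choose
    set z := (exists_eval hJ c b hb h).choose
    set w := (exists_eval hJ c b hb (g * h)).choose
    have h4 : (trunc M (g * h)).eval₂ c b
        - (trunc M g).eval₂ c b * (trunc M h).eval₂ c b ∈ J n := by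
      have e : trunc M (g * h) = trunc M (((trunc M g * trunc M h : Polynomial B)) : B⟦X⟧) := by
        rw [Polynomial.coe_mul, trunc_trunc_mul_trunc]
      rw [← Polynomial.eval₂_mul, e]
      set q := trunc M g * trunc M h
      have e2 : trunc (max M (q.natDegree + 1)) (q : B⟦X⟧) = q :=
        trunc_coe_eq_self (lt_of_lt_of_le (Nat.lt_succ_self _) (le_max_right _ _))
      conv => enter [2, 2]; rw [← e2]
      refine eval_trunc_sub_mem (J n) c b ?_ hM _
      obtain ⟨k, hk⟩ := Nat.exists_eq_add_of_le (le_max_left M (q.natDegree + 1))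
      rw [hk, pow_add]
      exact (J n).mul_mem_right _ hM
    have h5 := (J n).add_mem ((J n).mul_mem_left y h2)
      ((J n).mul_mem_right ((trunc M h).eval₂ c b) h1)
    have := (J n).sub_mem ((J n).add_mem h3 h4) h5
    convert this using 1
    ring

theorem evalHom_spec (hJ : IsComplSystem J) (c : B →+* A) (b : A) (hb : ∀ n, ∃ M, b ^ M ∈ J n)
    (g : B⟦X⟧) (n M : ℕ) (hM : b ^ M ∈ J n) :
    evalHom hJ c b hb g - (trunc M g).eval₂ c b ∈ J n :=
  (exists_eval hJ c b hb g).choose_spec n M hM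

theorem evalHom_coe (hJ : IsComplSystem J) (c : B →+* A) (b : A) (hb : ∀ n, ∃ M, b ^ M ∈ J n)
    (q : Polynomial B) : evalHom hJ c b hb (q : B⟦X⟧) = q.eval₂ c b := by
  rw [← sub_eq_zero]
  refine hJ.sep _ fun n => ?_
  obtain ⟨M, hM⟩ := hb n
  have := evalHom_spec hJ c b hb (q : B⟦X⟧) n (M + (q.natDegree + 1))
    (by rw [pow_add]; exact (J n).mul_mem_right _ hM)
  rwa [trunc_coe_eq_self (by omega)] at this

theorem evalHom_C (hJ : IsComplSystem J) (c : B →+* A) (b : A) (hb : ∀ n, ∃ M, b ^ M ∈ J n)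
    (a : B) : evalHom hJ c b hb (C a) = c a := by
  simpa using evalHom_coe hJ c b hb (Polynomial.C a)

theorem evalHom_X (hJ : IsComplSystem J) (c : B →+* A) (b : A) (hb : ∀ n, ∃ M, b ^ M ∈ J n) :
    evalHom hJ c b hb X = b := by
  simpa using evalHom_coe hJ c b hb Polynomial.X

end Eval

section Witt
variable (p : ℕ) [Fact p.Prime]

/-- The canonical ring homomorphism `ℤ_p = W(𝔽_p) → W(A)` for a ring `A` of characteristic `p`. -/
def zpToWitt (A : Type*) [CommRing A] [CharP A p] : ℤ_[p] →+* WittVector p A :=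
  (WittVector.map (ZMod.castHom dvd_rfl A)).comp (WittVector.equiv p).symm.toRingHom

theorem frobenius_zpToWitt (A : Type*) [CommRing A] [CharP A p] (a : ℤ_[p]) :
    WittVector.frobenius (zpToWitt p A a) = zpToWitt p A a := by
  simp only [zpToWitt, RingHom.comp_apply]
  have h : ∀ z : WittVector p (ZMod p), WittVector.frobenius (WittVector.map
      (ZMod.castHom dvd_rfl A) z) = WittVector.map (ZMod.castHom dvd_rfl A)
      (WittVector.frobenius z) := by
    intro z
    ext n
    simp only [WittVector.coeff_frobenius_charP, WittVector.map_coeff, ← map_pow, ZMod.pow_card]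
  rw [h, WittVector.frobenius_zmodp]

theorem map_zpToWitt {A B : Type*} [CommRing A] [CharP A p] [CommRing B] [CharP B p] (h : A →+* B)
    (a : ℤ_[p]) : WittVector.map h (zpToWitt p A a) = zpToWitt p B a := by
  simp only [zpToWitt, RingHom.comp_apply]
  ext n
  simp only [WittVector.map_coeff]
  exact RingHom.congr_fun (RingHom.ext_zmod (h.comp (ZMod.castHom dvd_rfl A)) _) _

section Sec
variable {p} {R : Type*} [CommRing R] [CharP R p]
variable (f : Polynomial ℤ_[p])

theorem eval_sub_dvd (hf : Polynomial.C (p : ℤ_[p]) ∣ f - Polynomial.X ^ p)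
    {S : Type*} [CommRing S] (c : ℤ_[p] →+* S) (a b : S) (n : ℕ)
    (h : (p : S) ^ (n + 1) ∣ a - b) : (p : S) ^ (n + 2) ∣ f.eval₂ c a - f.eval₂ c b := by
  obtain ⟨g, hg⟩ := hf
  obtain rfl : f = Polynomial.X ^ p + Polynomial.C (p : ℤ_[p]) * g := by rw [← hg]; ring
  have h1 : (p : S) ^ (n + 2) ∣ a ^ p - b ^ p := by
    rw [← Commute.mul_geom_sum₂ (Commute.all a b), pow_succ]
    exact mul_dvd_mul h (dvd_geom_sum₂_self (dvd_trans (dvd_pow_self _ (Nat.succ_ne_zero n)) h))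
  have h2 : (p : S) ^ (n + 2) ∣ (p : S) * (g.eval₂ c a - g.eval₂ c b) := by
    rw [pow_succ']
    refine mul_dvd_mul_left _ (dvd_trans h ?_)
    rw [Polynomial.eval₂_eq_eval_map, Polynomial.eval₂_eq_eval_map]
    exact Polynomial.sub_dvd_eval_sub _ _ _
  have := dvd_add h1 h2
  convert this using 1
  simp [Polynomial.eval₂_add, Polynomial.eval₂_mul]
  ring

theorem eval_coeff_zero (hf : Polynomial.C (p : ℤ_[p]) ∣ f - Polynomial.X ^ p)
    (y : WittVector p R) : (f.eval₂ (zpToWitt p R) y).coeff 0 = y.coeff 0 ^ p := by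
  obtain ⟨g, hg⟩ := hf
  obtain rfl : f = Polynomial.X ^ p + Polynomial.C (p : ℤ_[p]) * g := by rw [← hg]; ring
  have h1 : ∀ z : WittVector p R, z.coeff 0 = WittVector.constantCoeff z := fun _ => rfl
  rw [h1, h1, Polynomial.eval₂_add, Polynomial.eval₂_mul, Polynomial.eval₂_X_pow,
    Polynomial.eval₂_C, map_add, map_mul, map_pow, map_natCast, map_natCast, CharP.cast_eq_zero,
    zero_mul, add_zero]

variable [PerfectRing R p]

theorem exists_unique_section (hf : Polynomial.C (p : ℤ_[p]) ∣ f - Polynomial.X ^ p) (x : R) :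
    ∃! y : WittVector p R, y.coeff 0 = x ∧
      WittVector.frobenius y = f.eval₂ (zpToWitt p R) y := by
  let T : WittVector p R → WittVector p R := fun y =>
    (WittVector.frobeniusEquiv p R).symm (f.eval₂ (zpToWitt p R) y)
  have hfix : ∀ y, T y = y ↔ WittVector.frobenius y = f.eval₂ (zpToWitt p R) y := by
    intro y
    simp only [T]
    rw [RingEquiv.symm_apply_eq, WittVector.frobeniusEquiv_apply, eq_comm]
  have hfT : ∀ y, WittVector.frobenius (T y) = f.eval₂ (zpToWitt p R) y := by
    intro y
    rw [← WittVector.frobeniusEquiv_apply]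
    exact RingEquiv.apply_symm_apply _ _
  have hT0 : ∀ y, (T y).coeff 0 = y.coeff 0 := by
    intro y
    have h2 := congrArg (fun z => WittVector.coeff z 0) (hfT y)
    simp only [WittVector.coeff_frobenius_charP, eval_coeff_zero f hf] at h2
    exact (frobeniusEquiv R p).injective h2
  have hdvd : ∀ {n : ℕ} {a b : WittVector p R}, (p : WittVector p R) ^ n ∣ a →
      a = WittVector.frobenius b → (p : WittVector p R) ^ n ∣ b := by
    rintro n a b ⟨c, rfl⟩ h
    refine ⟨(WittVector.frobeniusEquiv p R).symm c, ?_⟩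
    apply (WittVector.frobeniusEquiv p R).injective
    rw [map_mul, map_pow, map_natCast, RingEquiv.apply_symm_apply, WittVector.frobeniusEquiv_apply,
      ← h]
  have hcon : ∀ n a b, (p : WittVector p R) ^ (n + 1) ∣ a - b →
      (p : WittVector p R) ^ (n + 2) ∣ T a - T b := by
    intro n a b h
    refine hdvd (eval_sub_dvd f hf (zpToWitt p R) a b n h) ?_
    rw [map_sub, hfT, hfT]
  have hzero : ∀ a b : WittVector p R, a.coeff 0 = b.coeff 0 → (p : WittVector p R) ^ 1 ∣ a - b := by
    intro a b h
    rw [pow_one, ← Ideal.mem_span_singleton, WittVector.mem_span_p_iff_coeff_zero_eq_zero]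
    change WittVector.constantCoeff (a - b) = 0
    rw [map_sub, sub_eq_zero]
    exact h
  have hsep : ∀ a b : WittVector p R, (∀ n, (p : WittVector p R) ^ (n + 1) ∣ a - b) → a = b := by
    intro a b h
    rw [← sub_eq_zero]
    ext n
    have := (WittVector.mem_span_p_pow_iff_le_coeff_eq_zero (a - b) (n + 1)).1
      (Ideal.mem_span_singleton.2 (h n)) n (Nat.lt_succ_self n)
    simpa using this
  let s : ℕ → WittVector p R := fun n => T^[n] (WittVector.teichmuller p x)
  have hs0 : ∀ n, (s n).coeff 0 = x := by
    intro n
    induction n with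
    | zero => simp [s]
    | succ n ih => simp only [s, Function.iterate_succ_apply']; rw [hT0]; exact ih
  have hs : ∀ n, (p : WittVector p R) ^ (n + 1) ∣ s (n + 1) - s n := by
    intro n
    induction n with
    | zero => exact hzero _ _ (by rw [hs0, hs0])
    | succ n ih =>
      have := hcon n _ _ ih
      simpa only [s, Function.iterate_succ_apply'] using this
  have hs' : ∀ {m n}, m ≤ n → (p : WittVector p R) ^ (m + 1) ∣ s n - s m := by
    intro m n h
    induction n, h using Nat.le_induction with
    | base => simp
    | succ n hmn ih =>
      have := dvd_add ((pow_dvd_pow (p : WittVector p R) (by omega : m + 1 ≤ n + 1)).trans (hs n)) ih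
      simpa using this
  obtain ⟨y, hy⟩ := IsPrecomplete.prec (I := Ideal.span {(p : WittVector p R)})
    (inferInstance : IsPrecomplete (Ideal.span {(p : WittVector p R)}) (WittVector p R)) (f := s) (by
      intro m n h
      rw [SModEq.sub_mem, smul_eq_mul, Ideal.mul_top, Ideal.span_singleton_pow,
        Ideal.mem_span_singleton, ← dvd_neg, neg_sub]
      exact (pow_dvd_pow _ (Nat.le_succ m)).trans (hs' h))
  have hy' : ∀ n, (p : WittVector p R) ^ n ∣ s n - y := by
    intro n
    have := hy n
    rwa [SModEq.sub_mem, smul_eq_mul, Ideal.mul_top, Ideal.span_singleton_pow,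
        Ideal.mem_span_singleton] at this
  have hy0 : y.coeff 0 = x := by
    have := hy' 1
    rw [pow_one, ← Ideal.mem_span_singleton, WittVector.mem_span_p_iff_coeff_zero_eq_zero] at this
    change WittVector.constantCoeff (s 1 - y) = 0 at this
    rw [map_sub, sub_eq_zero] at this
    exact this.symm.trans (hs0 1)
  refine ⟨y, ⟨hy0, (hfix y).1 ?_⟩, ?_⟩
  · refine hsep _ _ fun n => ?_
    have h1 := (pow_dvd_pow (p : WittVector p R) (Nat.le_succ _)).trans (hcon n _ _ (hy' (n + 1)))
    have h2 := (pow_dvd_pow (p : WittVector p R) (Nat.le_succ _)).trans (hy' (n + 2))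
    have h3 : T (s (n + 1)) = s (n + 2) := by simp only [s, Function.iterate_succ_apply']
    rw [h3] at h1
    have := dvd_sub h2 h1
    simpa using this
  · rintro z ⟨hz0, hz⟩
    rw [← hfix] at hz
    have hyT : T y = y := by
      refine hsep _ _ fun n => ?_
      have h1 := (pow_dvd_pow (p : WittVector p R) (Nat.le_succ _)).trans (hcon n _ _ (hy' (n + 1)))
      have h2 := (pow_dvd_pow (p : WittVector p R) (Nat.le_succ _)).trans (hy' (n + 2))
      have h3 : T (s (n + 1)) = s (n + 2) := by simp only [s, Function.iterate_succ_apply']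
      rw [h3] at h1
      have := dvd_sub h2 h1
      simpa using this
    refine hsep _ _ fun n => ?_
    induction n with
    | zero => exact hzero _ _ (by rw [hz0, hy0])
    | succ n ih =>
      have := hcon n _ _ ih
      rwa [hz, hyT] at this

/-- The section `{·}_f : R → W(R)` of reduction modulo `p`: the unique lift `y` of `x` with
`φ(y) = f(y)`. -/
def fSection (hf : Polynomial.C (p : ℤ_[p]) ∣ f - Polynomial.X ^ p) (x : R) : WittVector p R :=
  (exists_unique_section f hf x).choose

theorem fSection_coeff_zero (hf : Polynomial.C (p : ℤ_[p]) ∣ f - Polynomial.X ^ p) (x : R) :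
    (fSection f hf x).coeff 0 = x := (exists_unique_section f hf x).choose_spec.1.1

theorem frobenius_fSection (hf : Polynomial.C (p : ℤ_[p]) ∣ f - Polynomial.X ^ p) (x : R) :
    WittVector.frobenius (fSection f hf x) = f.eval₂ (zpToWitt p R) (fSection f hf x) :=
  (exists_unique_section f hf x).choose_spec.1.2

end Sec
end Witt

section PreTiltWitt
variable {p : ℕ} [Fact p.Prime] {O : Type*} [CommRing O] [Fact (¬ IsUnit (p : O))]

/-- The kernel of `W(R) → W_n(O/p)` induced by the `n`-th projection `R → O/p`, where
`R = lim O/p`. -/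
def wittIdeal (p : ℕ) [Fact p.Prime] (O : Type*) [CommRing O] [Fact (¬ IsUnit (p : O))] (n : ℕ) :
    Ideal (WittVector p (PreTilt O p)) :=
  RingHom.ker ((WittVector.truncate (p := p) n).comp
    (WittVector.map (PreTilt.coeff (O := O) (p := p) n)))

theorem mem_wittIdeal {n : ℕ} {x : WittVector p (PreTilt O p)} :
    x ∈ wittIdeal p O n ↔ ∀ i < n, PreTilt.coeff n (x.coeff i) = 0 := by
  rw [wittIdeal, ← RingHom.comap_ker, Ideal.mem_comap, WittVector.mem_ker_truncate]
  simp only [WittVector.map_coeff]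

theorem sub_mem_wittIdeal {n : ℕ} {x y : WittVector p (PreTilt O p)} :
    x - y ∈ wittIdeal p O n ↔
      ∀ i < n, PreTilt.coeff n (x.coeff i) = PreTilt.coeff n (y.coeff i) := by
  rw [wittIdeal, RingHom.mem_ker, map_sub, sub_eq_zero, TruncatedWittVector.ext_iff]
  simp only [RingHom.comp_apply, WittVector.coeff_truncate, WittVector.map_coeff]
  exact ⟨fun h i hi => h ⟨i, hi⟩, fun h i => h i i.2⟩

theorem preTilt_coeff_eq_of_le {x y : PreTilt O p} {m n : ℕ} (hmn : m ≤ n)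
    (h : PreTilt.coeff n x = PreTilt.coeff n y) : PreTilt.coeff m x = PreTilt.coeff m y := by
  induction n, hmn using Nat.le_induction with
  | base => exact h
  | succ n hmn ih =>
    apply ih
    rw [← PreTilt.coeff_pow_p x n, ← PreTilt.coeff_pow_p y n, h]

theorem preTilt_ext {x y : PreTilt O p} (h : ∀ n, PreTilt.coeff n x = PreTilt.coeff n y) : x = y :=
  Perfection.ext h

/-- The element of `R = lim O/p` given by a sequence with `s (n + 1) ^ p = s n`. -/
def preTiltMk (s : ℕ → ModP O p) (h : ∀ n, s (n + 1) ^ p = s n) : PreTilt O p := ⟨s, h⟩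

theorem coeff_preTiltMk (s : ℕ → ModP O p) (h : ∀ n, s (n + 1) ^ p = s n) (n : ℕ) :
    PreTilt.coeff n (preTiltMk s h) = s n := rfl

/-- `W(R)`, for `R = lim O/p`, is complete and separated for the ideals `wittIdeal`. -/
theorem wittIdeal_isComplSystem : IsComplSystem (wittIdeal p O) where
  sep x hx := by
    ext i
    refine preTilt_ext fun n => ?_
    have := mem_wittIdeal.1 (hx (n + i + 1)) i (by omega)
    rw [WittVector.zero_coeff]
    exact preTilt_coeff_eq_of_le (n := n + i + 1) (by omega) (by rw [this, map_zero])
  anti n x hx := by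
    rw [mem_wittIdeal] at hx ⊢
    intro i hi
    have := hx i (by omega)
    rw [← map_zero (PreTilt.coeff (O := O) (p := p) (n + 1))] at this
    have := preTilt_coeff_eq_of_le (Nat.le_succ n) this
    rwa [map_zero] at this
  compl s hs := by
    have hs1 : ∀ n i, i < n → PreTilt.coeff n ((s (n + 1)).coeff i)
        = PreTilt.coeff n ((s n).coeff i) := fun n => sub_mem_wittIdeal.1 (hs n)
    have hs2 : ∀ m n i k, k ≤ m → i < m → m ≤ n → PreTilt.coeff k ((s n).coeff i)
        = PreTilt.coeff k ((s m).coeff i) := by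
      intro m n i k hk hi hmn
      induction n, hmn using Nat.le_induction with
      | base => rfl
      | succ n hmn ih =>
        rw [← ih]
        exact preTilt_coeff_eq_of_le (n := n) (by omega) (hs1 n i (by omega))
    refine ⟨WittVector.mk p fun i => preTiltMk
      (fun j => PreTilt.coeff j ((s (j + i + 1)).coeff i)) ?_, ?_⟩
    · intro j
      rw [PreTilt.coeff_pow_p]
      exact hs2 (j + i + 1) (j + 1 + i + 1) i j (by omega) (by omega) (by omega)
    · intro n
      rw [sub_mem_wittIdeal]
      intro i hi
      rw [WittVector.coeff_mk, coeff_preTiltMk]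
      exact hs2 n (n + i + 1) i n le_rfl hi (by omega)

theorem verschiebung_pow {A : Type*} [CommRing A] [CharP A p] (c : WittVector p A) (n : ℕ) :
    ∃ z, WittVector.verschiebung c ^ n = WittVector.verschiebung^[n] z := by
  induction n with
  | zero => exact ⟨1, by simp⟩
  | succ n ih =>
    obtain ⟨z, hz⟩ := ih
    rw [pow_succ, hz]
    exact ⟨_, WittVector.iterate_verschiebung_mul z c n 1⟩

/-- An element of `W(R)` whose image in every `O/p` is nilpotent is topologically nilpotent. -/
theorem pow_mem_wittIdeal {b : WittVector p (PreTilt O p)}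
    (hb : ∀ n, ∃ N, PreTilt.coeff n (b.coeff 0) ^ N = 0) (n : ℕ) :
    ∃ M, b ^ M ∈ wittIdeal p O n := by
  obtain ⟨N, hN⟩ := hb n
  refine ⟨N * n, ?_⟩
  rw [wittIdeal, ← RingHom.comap_ker, Ideal.mem_comap, WittVector.mem_ker_truncate, pow_mul,
    map_pow]
  have h0 : (WittVector.map (PreTilt.coeff (O := O) (p := p) n) (b ^ N)).coeff 0 = 0 := by
    rw [map_pow]
    change WittVector.constantCoeff (WittVector.map (PreTilt.coeff (O := O) (p := p) n) b ^ N) = 0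
    rw [map_pow]
    change (WittVector.map (PreTilt.coeff (O := O) (p := p) n) b).coeff 0 ^ N = 0
    rw [WittVector.map_coeff, hN]
  have h1 := WittVector.eq_iterate_verschiebung (n := 1) (x :=
    WittVector.map (PreTilt.coeff (O := O) (p := p) n) (b ^ N)) (by
      intro i hi
      obtain rfl : i = 0 := by omega
      exact h0)
  rw [Function.iterate_one] at h1
  rw [h1]
  obtain ⟨z, hz⟩ := verschiebung_pow (WittVector.shift (WittVector.map
    (PreTilt.coeff (O := O) (p := p) n) (b ^ N)) 1) n
  rw [hz]
  intro i hi
  exact WittVector.iterate_verschiebung_coeff_eq_zero _ hi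

end PreTiltWitt

section Fields
open scoped NNReal

/-- The valuation ring `𝒪_K` of `K`. -/
abbrev intK (K : Type*) [NormedField K] [IsUltrametricDist K] : ValuationSubring K :=
  (NormedField.valuation (K := K)).valuationSubring

/-- The residue field `k` of `K`. -/
abbrev resK (K : Type*) [NormedField K] [IsUltrametricDist K] : Type _ :=
  IsLocalRing.ResidueField (intK K)

variable (p : ℕ) [Fact p.Prime]
variable (K : Type*) [NontriviallyNormedField K] [NormedAlgebra ℚ_[p] K]

theorem norm_p : ‖(p : K)‖ = (p : ℝ)⁻¹ := by
  rw [← map_natCast (algebraMap ℚ_[p] K) p, norm_algebraMap', Padic.norm_p]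

theorem norm_p_lt_one : ‖(p : K)‖ < 1 := by
  rw [norm_p]
  exact inv_lt_one_of_one_lt₀ (by exact_mod_cast (Fact.out : p.Prime).one_lt)

variable [IsUltrametricDist K]

instance intK_not_isUnit : Fact (¬ IsUnit ((p : ℕ) : intK K)) := by
  refine ⟨fun h => ?_⟩
  have := (Valuation.valuationSubring.integers (NormedField.valuation (K := K))).one_of_isUnit h
  have h2 := norm_p_lt_one p K
  rw [map_natCast, NormedField.valuation_apply] at this
  have h3 : ‖(p : K)‖ = 1 := congrArg NNReal.toReal this
  linarith

theorem p_mem_maximalIdeal : ((p : ℕ) : intK K) ∈ IsLocalRing.maximalIdeal (intK K) :=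
  (IsLocalRing.mem_maximalIdeal _).2 (intK_not_isUnit p K).1

/-- The absolute ramification index `e` of `K`, i.e. the normalized valuation of `p` in `𝒪_K`. -/
def ramIdx [IsDiscreteValuationRing (intK K)] : ℕ :=
  (IsDiscreteValuationRing.addVal (intK K) ((p : ℕ) : intK K)).toNat

theorem pow_ramIdx_mem [IsDiscreteValuationRing (intK K)] (x : intK K)
    (hx : x ∈ IsLocalRing.maximalIdeal (intK K)) {N : ℕ} (hN : ramIdx p K ≤ N) :
    x ^ N ∈ Ideal.span {((p : ℕ) : intK K)} := by
  have hp0 : ((p : ℕ) : intK K) ≠ 0 := by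
    intro h
    have h1 : (p : K) = 0 := congrArg Subtype.val h
    have h2 := norm_p p K
    rw [h1, norm_zero] at h2
    have : (0 : ℝ) < (p : ℝ)⁻¹ := by
      have : 0 < p := (Fact.out : p.Prime).pos
      positivity
    linarith
  rw [Ideal.mem_span_singleton]
  obtain ⟨ϖ, hϖ⟩ := IsDiscreteValuationRing.exists_irreducible (intK K)
  have h1 : ϖ ∣ x := by
    rw [hϖ.maximalIdeal_eq] at hx
    exact Ideal.mem_span_singleton.1 hx
  refine dvd_trans ?_ (pow_dvd_pow_of_dvd h1 N)
  rw [← IsDiscreteValuationRing.addVal_le_iff_dvd, hϖ.addVal_pow]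
  have h2 : IsDiscreteValuationRing.addVal (intK K) ((p : ℕ) : intK K) ≠ ⊤ := by
    rwa [Ne, IsDiscreteValuationRing.addVal_eq_top_iff]
  rw [← ENat.natCast_toNat h2]
  exact_mod_cast hN

/-- The canonical ring homomorphism `k → 𝒪_K/p`, the unique section of `𝒪_K/p → k`: it sends `c`
to `(a mod p) ^ (p ^ e)` for any lift `a` of `c ^ (1 / p ^ e)`. -/
def resToModK [IsDiscreteValuationRing (intK K)] [CharP (resK K) p] [PerfectField (resK K)] :
    resK K →+* ModP (intK K) p :=
  (Ideal.Quotient.lift (IsLocalRing.maximalIdeal (intK K))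
    ((iterateFrobenius (ModP (intK K) p) p (ramIdx p K)).comp
      (Ideal.Quotient.mk (Ideal.span {((p : ℕ) : intK K)}))) (by
    intro x hx
    rw [RingHom.comp_apply, iterateFrobenius_def, ← map_pow, Ideal.Quotient.eq_zero_iff_mem]
    exact pow_ramIdx_mem p K x hx
      ((Nat.lt_pow_self (Fact.out : p.Prime).one_lt).le))).comp
  (iterateFrobeniusEquiv (resK K) p (ramIdx p K)).symm.toRingHom

end Fields
section Closure
open scoped NNReal
variable (K : Type*) [NontriviallyNormedField K] [IsUltrametricDist K] [CompleteSpace K]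
variable (L : Type*) [Field L] [Algebra K L] [Algebra.IsAlgebraic K L]

/-- The unique extension to `L` of the absolute value of `K`, as a valuation. -/
def valL : Valuation L ℝ≥0 where
  toFun x := ⟨spectralNorm K L x, spectralNorm_nonneg x⟩
  map_zero' := Subtype.ext spectralNorm_zero
  map_one' := Subtype.ext (spectralMulAlgNorm K L).map_one'
  map_mul' x y := Subtype.ext ((spectralMulAlgNorm K L).map_mul' x y)
  map_add_le_max' x y := isNonarchimedean_spectralNorm (K := K) x y

theorem valL_apply (x : L) : (valL K L x : ℝ) = spectralNorm K L x := rfl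

theorem valL_algebraMap (x : K) : (valL K L (algebraMap K L x) : ℝ) = ‖x‖ :=
  spectralNorm_extends x

theorem valL_galois (g : L ≃ₐ[K] L) (x : L) : valL K L (g x) = valL K L x :=
  Subtype.ext (spectralNorm_eq_of_equiv g x).symm

/-- The valuation ring `𝒪_L` of `L`. -/
abbrev intL : ValuationSubring L := (valL K L).valuationSubring

/-- The inclusion `𝒪_K → 𝒪_L`. -/
def intKToL : intK K →+* intL K L :=
  ((algebraMap K L).comp (intK K).subtype).codRestrict (intL K L).toSubring fun x => by
    have h : valL K L (algebraMap K L x) = NormedField.valuation (x : K) :=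
      Subtype.ext (valL_algebraMap K L x)
    exact h.le.trans x.2

/-- The action of `g ∈ Gal(L/K)` on `𝒪_L`. -/
def galInt (g : L ≃ₐ[K] L) : intL K L →+* intL K L :=
  ((g : L →+* L).comp (intL K L).subtype).codRestrict (intL K L).toSubring fun x =>
    (valL_galois K L g x).le.trans x.2

theorem coe_galInt (g : L ≃ₐ[K] L) (x : intL K L) : (galInt K L g x : L) = g x := rfl

end Closure

section Tilt
open scoped NNReal
variable (p : ℕ) [Fact p.Prime]
variable (K : Type*) [NontriviallyNormedField K] [NormedAlgebra ℚ_[p] K] [IsUltrametricDist K]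
  [CompleteSpace K]
variable (L : Type*) [Field L] [Algebra K L] [Algebra.IsAlgebraic K L]

theorem valL_p : valL K L (p : L) = (p : ℝ≥0)⁻¹ := by
  apply NNReal.coe_injective
  rw [← map_natCast (algebraMap K L), valL_algebraMap, norm_p]
  simp

instance intL_not_isUnit : Fact (¬ IsUnit ((p : ℕ) : intL K L)) := by
  refine ⟨fun h => ?_⟩
  have := (Valuation.valuationSubring.integers (valL K L)).one_of_isUnit h
  have h2 := norm_p_lt_one p K
  rw [map_natCast, ← map_natCast (algebraMap K L)] at this
  have h3 := valL_algebraMap K L (p : K)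
  rw [this] at h3
  rw [← h3] at h2
  simp at h2

/-- The ring `R = lim 𝒪_L/p`, with the `p`-th power map as transition maps. -/
abbrev RR : Type _ := PreTilt (intL K L) p

/-- The absolute value on `R`: `|x| = lim |x̂ₙ| ^ (p ^ n)` for lifts `x̂ₙ` of the components `xₙ`
of `x`, with the normalization `|p| = 1 / p`; so `v_R(x) = - log_p |x|`. -/
def valR : Valuation (RR p K L) ℝ≥0 :=
  PreTilt.val L (valL K L) (intL K L) (Valuation.valuationSubring.integers (valL K L)) p

theorem valR_eq (x : RR p K L) (n : ℕ) (hn : PreTilt.coeff n x ≠ 0) (r : intL K L)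
    (hr : Ideal.Quotient.mk _ r = PreTilt.coeff n x) :
    valR p K L x = valL K L r ^ p ^ n := by
  change PreTilt.valAux L (valL K L) (intL K L) p x = _
  rw [PreTilt.valAux_eq (Valuation.valuationSubring.integers (valL K L)) hn, ← hr,
    ModP.preVal_mk (Valuation.valuationSubring.integers (valL K L)) (by rwa [hr])]
  rfl

theorem valR_le_one (x : RR p K L) : valR p K L x ≤ 1 := by
  by_cases h : ∃ n, PreTilt.coeff n x ≠ 0
  · obtain ⟨n, hn⟩ := h
    obtain ⟨r, hr⟩ := Ideal.Quotient.mk_surjective (PreTilt.coeff n x)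
    change PreTilt.valAux L (valL K L) (intL K L) p x ≤ 1
    rw [PreTilt.valAux_eq (Valuation.valuationSubring.integers (valL K L)) hn, ← hr,
      ModP.preVal_mk (Valuation.valuationSubring.integers (valL K L)) (by rwa [hr])]
    exact pow_le_one₀ zero_le r.2
  · push Not at h
    have : x = 0 := preTilt_ext fun n => by rw [h n, map_zero]
    rw [this, map_zero]
    exact zero_le

/-- The ideal `𝔪_R^{≥ c} = {x ∈ R | v_R(x) ≥ c}`, i.e. `|x| ≤ p ^ (-c)`. -/
def mR (c : ℝ) : Ideal (RR p K L) where
  carrier := {x | valR p K L x ≤ (p : ℝ≥0) ^ (-c)}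
  zero_mem' := by simp
  add_mem' {x y} hx hy := ((valR p K L).map_add x y).trans (max_le hx hy)
  smul_mem' a x hx := by
    change valR p K L (a * x) ≤ _
    rw [map_mul]
    exact (mul_le_of_le_one_left zero_le (valR_le_one p K L a)).trans hx

/-- The canonical ring homomorphism `k → R`, induced by `k → 𝒪_K/p → 𝒪_L/p`. -/
def resToR [IsDiscreteValuationRing (intK K)] [CharP (resK K) p] [PerfectField (resK K)] :
    resK K →+* RR p K L :=
  Perfection.lift p (resK K) (ModP (intL K L) p)
    ((Ideal.quotientMap (Ideal.span {((p : ℕ) : intL K L)}) (intKToL K L) (by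
      rw [Ideal.span_le, Set.singleton_subset_iff, SetLike.mem_coe, Ideal.mem_comap, map_natCast]
      exact Ideal.mem_span_singleton_self _)).comp (resToModK p K))

/-- The action of `g ∈ Gal(L/K)` on `𝒪_L/p`. -/
def galModP (g : L ≃ₐ[K] L) : ModP (intL K L) p →+* ModP (intL K L) p :=
  Ideal.quotientMap (Ideal.span {((p : ℕ) : intL K L)}) (galInt K L g) (by
    rw [Ideal.span_le, Set.singleton_subset_iff, SetLike.mem_coe, Ideal.mem_comap, map_natCast]
    exact Ideal.mem_span_singleton_self _)

/-- The action of `g ∈ Gal(L/K)` on `R`. -/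
def galR (g : L ≃ₐ[K] L) : RR p K L →+* RR p K L :=
  Perfection.map p (galModP p K L g)

/-- The action of `g ∈ Gal(L/K)` on `W(R)`. -/
def galW (g : L ≃ₐ[K] L) : WittVector p (RR p K L) →+* WittVector p (RR p K L) :=
  WittVector.map (galR p K L g)

/-- The structure map `ℤ_p → L`. -/
def zpToL : ℤ_[p] →+* L :=
  (algebraMap K L).comp ((algebraMap ℚ_[p] K).comp PadicInt.Coe.ringHom)

/-- The data defining an iterate extension: a polynomial
`f(u) = u ^ p + a_{p-1} u ^ (p-1) + ⋯ + a_1 u ∈ ℤ_p[u]` with `f ≡ u ^ p mod p`, and a sequence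
`(π_n)` in `L` with `π_0` a uniformizer of `K` and `f(π_{n+1}) = π_n`. -/
structure IterateDatum where
  f : Polynomial ℤ_[p]
  monic : f.Monic
  natDegree_eq : f.natDegree = p
  coeff_zero : f.coeff 0 = 0
  congr : Polynomial.C (p : ℤ_[p]) ∣ f - Polynomial.X ^ p
  π : ℕ → L
  unif : ∃ ϖ : intK K, Irreducible ϖ ∧ algebraMap K L ϖ = π 0
  iter : ∀ n, f.eval₂ (zpToL p K L) (π (n + 1)) = π n

end Tilt

section Embedding
open scoped NNReal
variable {p : ℕ} [Fact p.Prime]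
variable {K : Type*} [NontriviallyNormedField K] [NormedAlgebra ℚ_[p] K] [IsUltrametricDist K]
  [CompleteSpace K]
variable {L : Type*} [Field L] [Algebra K L] [Algebra.IsAlgebraic K L]
variable (D : IterateDatum p K L)

/-- `ℤ_p → 𝒪_L`. -/
def zpToIntL (p : ℕ) [Fact p.Prime] (K : Type*) [NontriviallyNormedField K]
    [NormedAlgebra ℚ_[p] K] [IsUltrametricDist K] [CompleteSpace K]
    (L : Type*) [Field L] [Algebra K L] [Algebra.IsAlgebraic K L] : ℤ_[p] →+* intL K L :=
  (zpToL p K L).codRestrict (intL K L).toSubring fun x => by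
    have h : (valL K L (zpToL p K L x) : ℝ) ≤ 1 := by
      rw [zpToL, RingHom.comp_apply, valL_algebraMap, RingHom.comp_apply, norm_algebraMap']
      exact x.2
    exact h

theorem IterateDatum.π_mem (n : ℕ) : D.π n ∈ intL K L := by
  induction n with
  | zero =>
    obtain ⟨ϖ, -, h⟩ := D.unif
    rw [← h]
    exact (intKToL K L ϖ).2
  | succ n ih =>
    have hint : IsIntegral (intL K L) (D.π (n + 1)) := by
      refine ⟨D.f.map (zpToIntL p K L) - Polynomial.C ⟨D.π n, ih⟩, ?_, ?_⟩
      · refine (D.monic.map _).sub_of_left ?_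
        refine lt_of_le_of_lt Polynomial.degree_C_le ?_
        rw [D.monic.degree_map, Polynomial.degree_eq_natDegree D.monic.ne_zero, D.natDegree_eq]
        exact_mod_cast (Fact.out : p.Prime).pos
      · rw [Polynomial.eval₂_sub, Polynomial.eval₂_map, Polynomial.eval₂_C, sub_eq_zero]
        exact D.iter n
    obtain ⟨y, hy⟩ := IsIntegrallyClosed.isIntegral_iff.1 hint
    rw [← hy]
    exact y.2

/-- `π_n` as an element of `𝒪_L`. -/
def IterateDatum.πInt (n : ℕ) : intL K L := ⟨D.π n, D.π_mem n⟩

theorem IterateDatum.πInt_iter (n : ℕ) :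
    D.f.eval₂ (zpToIntL p K L) (D.πInt (n + 1)) = D.πInt n := by
  apply Subtype.val_injective
  have := Polynomial.hom_eval₂ D.f (zpToIntL p K L) (intL K L).subtype (D.πInt (n + 1))
  exact this.trans (D.iter n)

theorem IterateDatum.πInt_pow (n : ℕ) :
    (Ideal.Quotient.mk (Ideal.span {((p : ℕ) : intL K L)}) (D.πInt (n + 1))) ^ p
      = Ideal.Quotient.mk _ (D.πInt n) := by
  rw [← map_pow, Ideal.Quotient.eq, Ideal.mem_span_singleton, ← D.πInt_iter n, ← dvd_neg, neg_sub]
  obtain ⟨g, hg⟩ := D.congr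
  have : D.f = Polynomial.X ^ p + Polynomial.C (p : ℤ_[p]) * g := by rw [← hg]; ring
  rw [this]
  simp [Polynomial.eval₂_add, Polynomial.eval₂_mul]

/-- The element `π̲ = (π_n mod p)_n` of `R`. -/
def IterateDatum.πR : RR p K L :=
  preTiltMk (fun n => Ideal.Quotient.mk _ (D.πInt n)) D.πInt_pow

/-- The element `{π̲}_f` of `W(R)`. -/
def IterateDatum.πW : WittVector p (RR p K L) := fSection D.f D.congr D.πR

variable [IsDiscreteValuationRing (intK K)]

theorem IterateDatum.coeff_πR_pow (n : ℕ) : ∃ N, PreTilt.coeff n D.πR ^ N = 0 := by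
  obtain ⟨ϖ, hϖ, h⟩ := D.unif
  have h0 : PreTilt.coeff 0 D.πR ^ ramIdx p K = 0 := by
    rw [IterateDatum.πR, coeff_preTiltMk, ← map_pow, Ideal.Quotient.eq_zero_iff_mem]
    have h1 := pow_ramIdx_mem p K ϖ (by
      rw [hϖ.maximalIdeal_eq]; exact Ideal.mem_span_singleton_self _) le_rfl
    have h2 : D.πInt 0 = intKToL K L ϖ := Subtype.ext h.symm
    rw [Ideal.mem_span_singleton] at h1 ⊢
    have := map_dvd (intKToL K L) h1
    rwa [map_pow, map_natCast, ← h2] at this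
  induction n with
  | zero => exact ⟨_, h0⟩
  | succ n ih =>
    obtain ⟨N, hN⟩ := ih
    exact ⟨p * N, by rw [pow_mul, PreTilt.coeff_pow_p, hN]⟩

theorem IterateDatum.πW_pow (n : ℕ) : ∃ M, D.πW ^ M ∈ wittIdeal p (intL K L) n :=
  pow_mem_wittIdeal (fun n => by
    rw [IterateDatum.πW, fSection_coeff_zero]; exact D.coeff_πR_pow n) n

variable [CharP (resK K) p] [PerfectField (resK K)]

/-- The ring `𝔖 = W(k)⟦u⟧`. -/
abbrev SS (p : ℕ) [Fact p.Prime] (K : Type*) [NormedField K] [IsUltrametricDist K] : Type _ :=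
  (WittVector p (resK K))⟦X⟧

/-- The embedding of `W(k)`-algebras `𝔖 → W(R)`, `∑ aᵢ uⁱ ↦ ∑ aᵢ {π̲}_f ^ i`. -/
def IterateDatum.emb : SS p K →+* WittVector p (RR p K L) :=
  evalHom (wittIdeal_isComplSystem (p := p) (O := intL K L)) (WittVector.map (resToR p K L))
    D.πW D.πW_pow

/-- The polynomial `f` viewed in `𝔖`. -/
def IterateDatum.fS : SS p K :=
  ((D.f.map (zpToWitt p (resK K)) : Polynomial (WittVector p (resK K))) : SS p K)

theorem IterateDatum.hasSubst_fS : HasSubst D.fS :=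
  HasSubst.of_constantCoeff_zero' (by
    rw [IterateDatum.fS, Polynomial.constantCoeff_coe, Polynomial.coeff_map, D.coeff_zero, map_zero])

/-- The Frobenius endomorphism `φ` of `𝔖`: the Witt vector Frobenius on `W(k)`, and `φ(u) = f(u)`. -/
def IterateDatum.frobS : SS p K →+* SS p K :=
  (substAlgHom D.hasSubst_fS).toRingHom.comp (PowerSeries.map WittVector.frobenius)

theorem IterateDatum.frobS_C (a : WittVector p (resK K)) :
    D.frobS (C a) = C (WittVector.frobenius a) := by
  rw [IterateDatum.frobS, RingHom.comp_apply, PowerSeries.map_C]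
  exact (substAlgHom D.hasSubst_fS).commutes _

theorem IterateDatum.frobS_X : D.frobS X = D.fS := by
  rw [IterateDatum.frobS, RingHom.comp_apply, PowerSeries.map_X]
  exact substAlgHom_X D.hasSubst_fS

theorem IterateDatum.emb_C (a : WittVector p (resK K)) :
    D.emb (C a) = WittVector.map (resToR p K L) a := evalHom_C _ _ _ _ a

theorem IterateDatum.emb_X : D.emb X = D.πW := evalHom_X _ _ _ _

theorem IterateDatum.emb_fS : D.emb D.fS = WittVector.frobenius D.πW := by
  rw [IterateDatum.emb, IterateDatum.fS, evalHom_coe, Polynomial.eval₂_map]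
  conv_rhs => rw [IterateDatum.πW, frobenius_fSection]
  rw [← IterateDatum.πW]
  congr 1
  ext1 a
  exact map_zpToWitt p (resToR p K L) a

/-- `𝔖 → W(R)` is compatible with the Frobenius endomorphisms. -/
theorem IterateDatum.emb_frobS (s : SS p K) : D.emb (D.frobS s) = WittVector.frobenius (D.emb s) := by
  refine RingHom.congr_fun (f := D.emb.comp D.frobS) (g := WittVector.frobenius.comp D.emb)
    (powerSeries_hom_ext (J := wittIdeal p (intL K L)) wittIdeal_isComplSystem.sep _ _ ?_ ?_ ?_) s
  · intro a
    simp only [RingHom.comp_apply, D.frobS_C, D.emb_C]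
    ext n
    simp [WittVector.coeff_frobenius_charP]
  · simp only [RingHom.comp_apply, D.frobS_X, D.emb_X, D.emb_fS]
  · refine pow_mem_wittIdeal fun n => ?_
    simp only [RingHom.comp_apply, D.frobS_X, D.emb_fS, WittVector.coeff_frobenius_charP]
    obtain ⟨N, hN⟩ := D.coeff_πR_pow n
    refine ⟨N, ?_⟩
    rw [IterateDatum.πW, fSection_coeff_zero, map_pow, ← pow_mul, mul_comm, pow_mul, hN,
      zero_pow (Fact.out : p.Prime).ne_zero]

/-- Reduction modulo `p`, `𝔖 → k⟦u⟧`. -/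
def redS (p : ℕ) [Fact p.Prime] (K : Type*) [NormedField K] [IsUltrametricDist K] :
    SS p K →+* (resK K)⟦X⟧ :=
  PowerSeries.map WittVector.constantCoeff

theorem IterateDatum.redS_frobS_X : redS p K (D.frobS X) = X ^ p := by
  have : CharP (resK K)⟦X⟧ p := charP_of_injective_ringHom (f := C (R := resK K)) C_injective p
  obtain ⟨g, hg⟩ := D.congr
  have hf : D.f = Polynomial.X ^ p + Polynomial.C (p : ℤ_[p]) * g := by rw [← hg]; ring
  let F : Polynomial ℤ_[p] →+* (resK K)⟦X⟧ := ((redS p K).comp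
    Polynomial.coeToPowerSeries.ringHom).comp (Polynomial.mapRingHom (zpToWitt p (resK K)))
  have hF : redS p K (D.frobS X) = F D.f := by rw [D.frobS_X]; rfl
  have hFX : F Polynomial.X = X := by simp [F, redS]
  rw [hF, hf, map_add, map_mul, map_pow, hFX, map_natCast, map_natCast, CharP.cast_eq_zero,
    zero_mul, add_zero]

/-- `φ` on `𝔖` lifts the `p`-th power map of `k⟦u⟧`. -/
theorem IterateDatum.redS_frobS (s : SS p K) : redS p K (D.frobS s) = redS p K s ^ p := by
  have : CharP (resK K)⟦X⟧ p := charP_of_injective_ringHom (f := C (R := resK K)) C_injective p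
  refine RingHom.congr_fun (f := (redS p K).comp D.frobS)
    (g := (frobenius (resK K)⟦X⟧ p).comp (redS p K))
    (powerSeries_hom_ext (J := fun n => Ideal.span {(X : (resK K)⟦X⟧) ^ n}) ?_ _ _ ?_ ?_ ?_) s
  · intro x hx
    ext n
    have := hx (n + 1)
    rw [Ideal.mem_span_singleton, X_pow_dvd_iff] at this
    simpa using this n (Nat.lt_succ_self n)
  · intro a
    simp only [RingHom.comp_apply, D.frobS_C, redS, PowerSeries.map_C, frobenius_def, ← map_pow]
    congr 1
    rw [map_pow]
    exact WittVector.coeff_frobenius_charP p a 0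
  · simp only [RingHom.comp_apply, D.redS_frobS_X]
    rw [frobenius_def, redS, PowerSeries.map_X]
  · intro n
    refine ⟨n, ?_⟩
    simp only [RingHom.comp_apply, D.redS_frobS_X]
    rw [Ideal.mem_span_singleton, ← pow_mul]
    exact pow_dvd_pow _ (Nat.le_mul_of_pos_left n (Fact.out : p.Prime).pos)

end Embedding

section SimpleModule

/-- The module `𝔐(𝔫) = ⨁_{i ∈ ℤ/d} k⟦u⟧ eᵢ`. -/
def SimpleKisin (K : Type*) [NormedField K] [IsUltrametricDist K] {d : ℕ} (_n : ZMod d → ℕ) :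
    Type _ :=
  ZMod d → (resK K)⟦X⟧

instance (K : Type*) [NormedField K] [IsUltrametricDist K] {d : ℕ} (n : ZMod d → ℕ) :
    AddCommGroup (SimpleKisin K n) :=
  inferInstanceAs (AddCommGroup (ZMod d → (resK K)⟦X⟧))

/-- `𝔖` acts on `𝔐(𝔫)` through reduction modulo `p`. -/
instance (p : ℕ) [Fact p.Prime] (K : Type*) [NormedField K] [IsUltrametricDist K] {d : ℕ}
    (n : ZMod d → ℕ) : Module (SS p K) (SimpleKisin K n) :=
  Module.compHom (ZMod d → (resK K)⟦X⟧) (redS p K)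

theorem SimpleKisin.smul_apply (p : ℕ) [Fact p.Prime] (K : Type*) [NormedField K]
    [IsUltrametricDist K] {d : ℕ} (n : ZMod d → ℕ) (s : SS p K) (x : SimpleKisin K n)
    (i : ZMod d) : (s • x) i = redS p K s * x i := rfl

/-- The Frobenius of `𝔐(𝔫)`: the map that is semilinear over the `p`-th power map of `k⟦u⟧` and
sends `eᵢ` to `u ^ nᵢ e_{i+1}`. -/
def SimpleKisin.phi (p : ℕ) [Fact p.Prime] (K : Type*) [NormedField K] [IsUltrametricDist K]
    [CharP (resK K) p] {d : ℕ} (n : ZMod d → ℕ) : SimpleKisin K n →+ SimpleKisin K n where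
  toFun x i := X ^ n (i - 1) * x (i - 1) ^ p
  map_zero' := by
    funext i
    change X ^ n (i - 1) * (0 : (resK K)⟦X⟧) ^ p = 0
    rw [zero_pow (Fact.out : p.Prime).ne_zero, mul_zero]
  map_add' x y := by
    have : CharP (resK K)⟦X⟧ p := charP_of_injective_ringHom (f := C (R := resK K)) C_injective p
    funext i
    change X ^ n (i - 1) * (x (i - 1) + y (i - 1)) ^ p
      = X ^ n (i - 1) * x (i - 1) ^ p + X ^ n (i - 1) * y (i - 1) ^ p
    rw [add_pow_char, mul_add]

variable {p : ℕ} [Fact p.Prime]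
variable {K : Type*} [NontriviallyNormedField K] [NormedAlgebra ℚ_[p] K] [IsUltrametricDist K]
  [CompleteSpace K] [IsDiscreteValuationRing (intK K)] [CharP (resK K) p] [PerfectField (resK K)]
variable {L : Type*} [Field L] [Algebra K L] [Algebra.IsAlgebraic K L]

theorem SimpleKisin.phi_smul (D : IterateDatum p K L) {d : ℕ} (n : ZMod d → ℕ) (s : SS p K)
    (x : SimpleKisin K n) :
    SimpleKisin.phi p K n (s • x) = D.frobS s • SimpleKisin.phi p K n x := by
  funext i
  rw [SimpleKisin.smul_apply, D.redS_frobS]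
  change X ^ n (i - 1) * (redS p K s * x (i - 1)) ^ p
    = redS p K s ^ p * (X ^ n (i - 1) * x (i - 1) ^ p)
  ring

/-- The basis vector `eᵢ` of `𝔐(𝔫)`. -/
def SimpleKisin.e (K : Type*) [NormedField K] [IsUltrametricDist K] {d : ℕ} (n : ZMod d → ℕ)
    (i : ZMod d) : SimpleKisin K n :=
  Pi.single (M := fun _ => (resK K)⟦X⟧) i 1

theorem SimpleKisin.phi_e {d : ℕ} (n : ZMod d → ℕ) (i : ZMod d) :
    SimpleKisin.phi p K n (SimpleKisin.e K n i) = (X : SS p K) ^ n i • SimpleKisin.e K n (i + 1) := by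
  funext j
  rw [SimpleKisin.smul_apply]
  change X ^ n (j - 1) * (Pi.single (M := fun _ => (resK K)⟦X⟧) i 1 (j - 1)) ^ p
    = redS p K (X ^ n i) * Pi.single (M := fun _ => (resK K)⟦X⟧) (i + 1) 1 j
  by_cases h : j = i + 1
  · subst h; simp [redS]
  · have h' : j - 1 ≠ i := fun h2 => h (by rw [← h2]; ring)
    simp [Pi.single_eq_of_ne h, Pi.single_eq_of_ne h', (Fact.out : p.Prime).ne_zero]

/-- `W(R)`, viewed as an `𝔖`-algebra through `φ : 𝔖 → 𝔖` followed by `𝔖 → W(R)`. -/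
def WPhi (_D : IterateDatum p K L) : Type _ := WittVector p (RR p K L)

instance (D : IterateDatum p K L) : CommRing (WPhi D) :=
  inferInstanceAs (CommRing (WittVector p (RR p K L)))

instance (D : IterateDatum p K L) : Algebra (SS p K) (WPhi D) :=
  (D.emb.comp D.frobS : SS p K →+* WittVector p (RR p K L)).toAlgebra

variable (D : IterateDatum p K L)

/-- The Frobenius of `W(R)`. -/
def WPhi.frob : WPhi D →+* WPhi D :=
  (WittVector.frobenius : WittVector p (RR p K L) →+* WittVector p (RR p K L))

/-- The action of `g ∈ Gal(L/K)` on `W(R)`. -/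
def WPhi.gal (g : L ≃ₐ[K] L) : WPhi D →+* WPhi D := galW p K L g

/-- The elements of `𝔖`, viewed in `W(R)`. -/
def WPhi.ofS : SS p K →+* WPhi D := D.emb

/-- The ideal of all elements of `W(R)` whose reduction modulo `p` lies in `𝔪_R^{≥ c}`. -/
def WPhi.mIdeal (c : ℝ) : Ideal (WPhi D) :=
  (mR p K L c).comap
    (WittVector.constantCoeff : WittVector p (RR p K L) →+* RR p K L)

theorem WPhi.frob_algebraMap (s : SS p K) :
    WPhi.frob D (algebraMap (SS p K) (WPhi D) s) = algebraMap (SS p K) (WPhi D) (D.frobS s) :=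
  (D.emb_frobS (D.frobS s)).symm

variable {d : ℕ} (n : ZMod d → ℕ)

/-- `W(R) ⊗_{φ, 𝔖} 𝔐(𝔫)`. -/
abbrev PhiTensor : Type _ := WPhi D ⊗[SS p K] SimpleKisin K n

/-- `φ_{W(R)} ⊗ φ_{𝔐(𝔫)}` on `W(R) ⊗_{φ, 𝔖} 𝔐(𝔫)`. -/
def phiTensor : PhiTensor D n →+ PhiTensor D n :=
  TensorProduct.liftAddHom
    { toFun := fun a =>
        { toFun := fun x => WPhi.frob D a ⊗ₜ[SS p K] SimpleKisin.phi p K n x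
          map_zero' := by rw [map_zero, tmul_zero]
          map_add' := fun x y => by rw [map_add, tmul_add] }
      map_zero' := by ext x; simp
      map_add' := fun a b => by ext x; simp [add_tmul] }
    (fun s a x => by
      change WPhi.frob D (s • a) ⊗ₜ[SS p K] SimpleKisin.phi p K n x
        = WPhi.frob D a ⊗ₜ[SS p K] SimpleKisin.phi p K n (s • x)
      rw [SimpleKisin.phi_smul D, ← smul_tmul, Algebra.smul_def, Algebra.smul_def, map_mul,
        WPhi.frob_algebraMap])

theorem phiTensor_tmul (a : WPhi D) (x : SimpleKisin K n) :
    phiTensor D n (a ⊗ₜ x) = WPhi.frob D a ⊗ₜ SimpleKisin.phi p K n x := rfl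

/-- The subgroup `G_π = Gal(L/K_π)` of `Gal(L/K)`, where `K_π` is generated over `K` by all
`π_n`. -/
def IterateDatum.galPi : Subgroup (L ≃ₐ[K] L) :=
  (IntermediateField.adjoin K (Set.range D.π)).fixingSubgroup

/-- `ρ` is a `W(R)`-semilinear action of `Gal(L/K)` on `W(R) ⊗_{φ, 𝔖} 𝔐(𝔫)` that commutes with
`φ`, is trivial for `G_π` on `𝔖 ⊗_{φ, 𝔖} 𝔐(𝔫)`, and satisfies
`g(1 ⊗ x) - 1 ⊗ x ∈ 𝔪_R^{≥ p² / (p - 1)} ⊗_{φ, 𝔖} 𝔐(𝔫)`. Since `p` kills `𝔐(𝔫)`,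
`W(R) ⊗_{φ, 𝔖} 𝔐(𝔫) = R ⊗_{φ, 𝔖} 𝔐(𝔫)`, and the last module is the submodule generated by all
`a ⊗ x` with `a mod p ∈ 𝔪_R^{≥ p² / (p - 1)}`. -/
structure IsKisinAction (ρ : (L ≃ₐ[K] L) →* AddMonoid.End (PhiTensor D n)) : Prop where
  semilinear : ∀ (g : L ≃ₐ[K] L) (a : WPhi D) (y : PhiTensor D n),
    ρ g (a • y) = WPhi.gal D g a • ρ g y
  comm : ∀ (g : L ≃ₐ[K] L) (y : PhiTensor D n), ρ g (phiTensor D n y) = phiTensor D n (ρ g y)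
  trivial : ∀ g ∈ D.galPi, ∀ (s : SS p K) (x : SimpleKisin K n),
    ρ g (WPhi.ofS D s ⊗ₜ x) = WPhi.ofS D s ⊗ₜ x
  congr : ∀ (g : L ≃ₐ[K] L) (x : SimpleKisin K n),
    ρ g (1 ⊗ₜ x) - 1 ⊗ₜ x ∈
      WPhi.mIdeal D ((p : ℝ) ^ 2 / ((p : ℝ) - 1)) • (⊤ : Submodule (WPhi D) (PhiTensor D n))

end SimpleModule

end IterKisin
end

open IterKisin

/-!
Modulo `p`, the module `W(R) ⊗_{φ, 𝔖} 𝔐(𝔫)` is free over `R` on the vectors `1 ⊗ eᵢ` (`coord`),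
and `φ(1 ⊗ eᵢ) = π̲ ^ (p nᵢ) (1 ⊗ e_{i+1})` there, because `u` acts on `R` as `π̲ ^ p`. A semilinear
action is thus a matrix-valued cocycle, and it commutes with `φ` exactly if
`g(π̲ ^ p) ^ nᵢ A_{i+1,j+1} = A_{ij} ^ p π̲ ^ (p nⱼ)` (`IsKisinAction.coord_intertwining`).

The arithmetic input is `g(π̲) = χ π̲` with `v_R(χ - 1) ≥ p / (p - 1)`
(`IterateDatum.exists_galR_πR`). The components of `χ` are `y_n = g(π_n) / π_n`. Since
`v_p(a_i) ≥ 2`, the relation `f(π_{n+1}) = π_n` shows that `y_{n+1} ^ p` is so close to `y_n` that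
a bound for `y_n - 1` yields one for `y_{n+1} - 1`, starting from `y_0 = 1`.

For existence the matrix is taken diagonal. With `η = χ ^ p` the condition reads
`a_{i+1} = η ^ (-nᵢ) aᵢ ^ p`; the right hand side is a contraction of `1 + 𝔪_R^{≥ c}` for `c ≥ 1`,
so there is exactly one solution in `1 + 𝔪_R^{≥ p² / (p - 1)}` (`exists_frobenius_system`,
`frobenius_system_unique`). Uniqueness makes the solutions for varying `g` a cocycle that is trivial
on the stabilizer of `π̲` (`IterateDatum.exists_cocycle`).

For uniqueness, the difference `b` of two matrices satisfies the same equation, by additivity of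
the Frobenius, and has entries in `𝔪_R^{≥ p² / (p - 1)}`. If `nᵢ ≤ p - 1`, then
`v_R(b_{i+1,j+1}) ≥ p v_R(b_{ij}) - p (p - 1) ≥ v_R(b_{ij}) + p`. The indices being cyclic, every
entry is reached by arbitrarily many such steps, so its valuation is infinite
(`IterateDatum.eq_zero_of_intertwining`).
-/

noncomputable section
namespace IterKisin
open PowerSeries TensorProduct
open scoped NNReal

/-! ### The valuation and the Galois action on `R` -/

section Tilt
variable {p : ℕ} [Fact p.Prime]
variable {K : Type*} [NontriviallyNormedField K] [NormedAlgebra ℚ_[p] K] [IsUltrametricDist K]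
  [CompleteSpace K]
variable {L : Type*} [Field L] [Algebra K L] [Algebra.IsAlgebraic K L]

theorem valL_intL_le_inv_iff {x : intL K L} :
    valL K L x ≤ (p : ℝ≥0)⁻¹ ↔ Ideal.Quotient.mk (Ideal.span {((p : ℕ) : intL K L)}) x = 0 := by
  have h := ModP.v_p_lt_val
    (Valuation.valuationSubring.integers (valL K L)) (p := p) (x := x)
  rw [valL_p] at h
  rw [← not_iff_not, not_le]
  exact h

theorem valR_eq_zero {x : RR p K L} : valR p K L x = 0 ↔ x = 0 :=
  PreTilt.map_eq_zero (Valuation.valuationSubring.integers (valL K L))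

instance isDomain_RR : IsDomain (RR p K L) :=
  PreTilt.isDomain L (valL K L) (intL K L) (Valuation.valuationSubring.integers (valL K L)) p

theorem exists_coeff_ne_zero {x : RR p K L} (hx : x ≠ 0) : ∃ n, PreTilt.coeff n x ≠ 0 := by
  by_contra! h
  exact hx (preTilt_ext fun n => by rw [h n, map_zero])

theorem coeff_eq_zero_of_valR_le {x : RR p K L} {n : ℕ} (h : valR p K L x ≤ (p : ℝ≥0)⁻¹ ^ p ^ n) :
    PreTilt.coeff n x = 0 := by
  by_contra hn
  obtain ⟨r, hr⟩ := Ideal.Quotient.mk_surjective (PreTilt.coeff n x)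
  rw [valR_eq p K L x n hn r hr] at h
  have h1 := le_of_pow_le_pow_left₀ (pow_ne_zero n (Fact.out : p.Prime).ne_zero) zero_le h
  rw [valL_intL_le_inv_iff] at h1
  exact hn (hr.symm.trans h1)

theorem valR_le_of_coeff_eq_zero {x : RR p K L} {n : ℕ} (h : PreTilt.coeff n x = 0) :
    valR p K L x ≤ (p : ℝ≥0)⁻¹ ^ p ^ n := by
  by_cases hx : x = 0
  · rw [hx, map_zero]; exact zero_le
  obtain ⟨m, hm⟩ := exists_coeff_ne_zero hx
  have hnm : n ≤ m := by
    by_contra! hlt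
    rw [← map_zero (PreTilt.coeff n)] at h
    exact hm ((preTilt_coeff_eq_of_le hlt.le h).trans (map_zero _))
  obtain ⟨k, rfl⟩ := Nat.exists_eq_add_of_le hnm
  obtain ⟨r, hr⟩ := Ideal.Quotient.mk_surjective (PreTilt.coeff (n + k) x)
  have hk : ∀ k, PreTilt.coeff (n + k) x ^ p ^ k = PreTilt.coeff n x := by
    intro k
    induction k with
    | zero => simp
    | succ k ih => rw [pow_succ', pow_mul, ← add_assoc, PreTilt.coeff_pow_p, ih]
  have h1 : valL K L ((r ^ p ^ k : intL K L) : L) ≤ (p : ℝ≥0)⁻¹ := by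
    rw [valL_intL_le_inv_iff, map_pow]
    exact (congrArg (· ^ p ^ k) hr).trans ((hk k).trans h)
  rw [valR_eq p K L x _ hm r hr, add_comm, pow_add, pow_mul]
  refine pow_le_pow_left₀ zero_le ?_ _
  simpa using h1

theorem galModP_mk (g : L ≃ₐ[K] L) (x : intL K L) :
    galModP p K L g (Ideal.Quotient.mk _ x) = Ideal.Quotient.mk _ (galInt K L g x) := rfl

theorem coeff_galR (g : L ≃ₐ[K] L) (n : ℕ) (x : RR p K L) :
    PreTilt.coeff n (galR p K L g x) = galModP p K L g (PreTilt.coeff n x) := rfl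

theorem galModP_one (x : ModP (intL K L) p) : galModP p K L 1 x = x := by
  obtain ⟨x, rfl⟩ := Ideal.Quotient.mk_surjective x
  rfl

theorem galModP_mul (g h : L ≃ₐ[K] L) (x : ModP (intL K L) p) :
    galModP p K L (g * h) x = galModP p K L g (galModP p K L h x) := by
  obtain ⟨x, rfl⟩ := Ideal.Quotient.mk_surjective x
  rfl

theorem galR_one (x : RR p K L) : galR p K L 1 x = x :=
  preTilt_ext fun n => by rw [coeff_galR, galModP_one]

theorem galR_mul (g h : L ≃ₐ[K] L) (x : RR p K L) :
    galR p K L (g * h) x = galR p K L g (galR p K L h x) :=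
  preTilt_ext fun n => by simp only [coeff_galR, galModP_mul]

theorem galR_injective (g : L ≃ₐ[K] L) : Function.Injective (galR p K L g) :=
  Function.LeftInverse.injective (g := galR p K L g⁻¹) fun x => by
    rw [← galR_mul, inv_mul_cancel, galR_one]

theorem valR_galR (g : L ≃ₐ[K] L) (x : RR p K L) : valR p K L (galR p K L g x) = valR p K L x := by
  by_cases hx : x = 0
  · rw [hx, map_zero]
  have hgx : galR p K L g x ≠ 0 := by
    rwa [Ne, map_eq_zero_iff _ (galR_injective g)]
  obtain ⟨n, hn⟩ := exists_coeff_ne_zero hgx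
  have hn' : PreTilt.coeff n x ≠ 0 := fun h => hn (by rw [coeff_galR, h, map_zero])
  obtain ⟨r, hr⟩ := Ideal.Quotient.mk_surjective (PreTilt.coeff n x)
  rw [valR_eq p K L x n hn' r hr, valR_eq p K L _ n hn (galInt K L g r) (by
    rw [coeff_galR, ← hr, galModP_mk]), coe_galInt, valL_galois]

theorem mem_mR {c : ℝ} {x : RR p K L} : x ∈ mR p K L c ↔ valR p K L x ≤ (p : ℝ≥0) ^ (-c) := Iff.rfl

theorem galR_mem_mR {c : ℝ} {x : RR p K L} (g : L ≃ₐ[K] L) (hx : x ∈ mR p K L c) :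
    galR p K L g x ∈ mR p K L c := by
  rwa [mem_mR, valR_galR]

/-- The Galois action on `R` is trivial on the image of the residue field `k`. -/
theorem galR_resToR [IsDiscreteValuationRing (intK K)] [CharP (resK K) p] [PerfectField (resK K)]
    (g : L ≃ₐ[K] L) (c : resK K) : galR p K L g (resToR p K L c) = resToR p K L c := by
  have key : ∀ z : ModP (intK K) p, galModP p K L g ((Ideal.quotientMap
      (Ideal.span {((p : ℕ) : intL K L)}) (intKToL K L) (by
      rw [Ideal.span_le, Set.singleton_subset_iff, SetLike.mem_coe, Ideal.mem_comap, map_natCast]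
      exact Ideal.mem_span_singleton_self _)) z) = Ideal.quotientMap
      (Ideal.span {((p : ℕ) : intL K L)}) (intKToL K L) (by
      rw [Ideal.span_le, Set.singleton_subset_iff, SetLike.mem_coe, Ideal.mem_comap, map_natCast]
      exact Ideal.mem_span_singleton_self _) z := by
    intro z
    obtain ⟨z, rfl⟩ := Ideal.Quotient.mk_surjective z
    rw [Ideal.quotientMap_mk]
    refine congrArg (Ideal.Quotient.mk _) (Subtype.ext ?_)
    exact g.commutes (z : K)
  exact preTilt_ext fun n => key _

end Tilt

/-! ### The quotients `g(π_n) / π_n` -/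

section Iterate
variable {p : ℕ} [Fact p.Prime]
variable {K : Type*} [NontriviallyNormedField K] [NormedAlgebra ℚ_[p] K] [IsUltrametricDist K]
  [CompleteSpace K] [IsDiscreteValuationRing (intK K)]
variable {L : Type*} [Field L] [Algebra K L] [Algebra.IsAlgebraic K L]

theorem valL_zpToL (a : ℤ_[p]) : (valL K L (zpToL p K L a) : ℝ) = ‖a‖ := by
  rw [zpToL, RingHom.comp_apply, valL_algebraMap, RingHom.comp_apply, norm_algebraMap']
  rfl

theorem inv_p_lt_one : ((p : ℝ≥0)⁻¹) < 1 :=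
  inv_lt_one_of_one_lt₀ (by exact_mod_cast (Fact.out : p.Prime).one_lt)

theorem inv_p_pos : 0 < ((p : ℝ≥0)⁻¹) :=
  inv_pos.2 (by exact_mod_cast (Fact.out : p.Prime).pos)

variable (D : IterateDatum p K L)

theorem IterateDatum.eval₂_f {A : Type*} [CommRing A] (c : ℤ_[p] →+* A) (x : A) :
    D.f.eval₂ c x = x ^ p + ∑ i ∈ Finset.range (p - 1), c (D.f.coeff (i + 1)) * x ^ (i + 1) := by
  have h1 : D.f.coeff p = 1 := by
    have := D.monic.coeff_natDegree
    rwa [D.natDegree_eq] at this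
  rw [Polynomial.eval₂_eq_sum_range, D.natDegree_eq, Finset.sum_range_succ, h1, map_one, one_mul,
    add_comm]
  have h2 := Finset.sum_range_succ' (fun i => c (D.f.coeff i) * x ^ i) (p - 1)
  rw [Nat.sub_add_cancel (Fact.out : p.Prime).one_le, D.coeff_zero, map_zero, zero_mul,
    add_zero] at h2
  rw [h2]

theorem IterateDatum.valL_π_le_one (n : ℕ) : valL K L (D.π n) ≤ 1 := D.π_mem n

/-- `p` is a multiple of the uniformizer `π_0`. -/
theorem IterateDatum.le_valL_π_zero : (p : ℝ≥0)⁻¹ ≤ valL K L (D.π 0) := by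
  obtain ⟨ϖ, hϖ, h⟩ := D.unif
  have h1 := p_mem_maximalIdeal p K
  rw [hϖ.maximalIdeal_eq, Ideal.mem_span_singleton] at h1
  obtain ⟨t, ht⟩ := map_dvd (intKToL K L) h1
  rw [map_natCast] at ht
  have h2 : (p : L) = D.π 0 * (t : L) := by rw [← h]; exact congrArg Subtype.val ht
  rw [← valL_p p K L, h2, map_mul]
  exact mul_le_of_le_one_right zero_le t.2

variable (hf : ∀ i ∈ Finset.Icc 1 (p - 1), ‖D.f.coeff i‖ < (p : ℝ)⁻¹)
include hf

/-- Elements of `ℤ_p` have integral valuation, so `v_p(a_i) > 1` gives `v_p(a_i) ≥ 2`. -/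
theorem IterateDatum.valL_coeff_le {i : ℕ} (hi : i ∈ Finset.range (p - 1)) :
    valL K L (zpToL p K L (D.f.coeff (i + 1))) ≤ (p : ℝ≥0)⁻¹ ^ 2 := by
  have h1 := hf (i + 1) (by rw [Finset.mem_range] at hi; rw [Finset.mem_Icc]; omega)
  rw [← NNReal.coe_le_coe, valL_zpToL]
  have h2 := (PadicInt.norm_le_pow_iff_norm_lt_pow_add_one (D.f.coeff (i + 1)) (-2)).2 (by
    simpa using h1)
  refine h2.trans (le_of_eq ?_)
  rw [zpow_neg]
  push_cast
  rw [inv_pow]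
  rfl

theorem IterateDatum.valL_sum_le (x : L) (hx : valL K L x ≤ 1) (c : ℕ → L) {C : ℝ≥0}
    (hc : ∀ i, valL K L (c i) ≤ C) :
    valL K L (∑ i ∈ Finset.range (p - 1), zpToL p K L (D.f.coeff (i + 1)) * x ^ (i + 1) * c i)
      ≤ (p : ℝ≥0)⁻¹ ^ 2 * C := by
  refine Valuation.map_sum_le _ fun i hi => ?_
  rw [map_mul, map_mul, map_pow]
  exact mul_le_mul' (mul_le_of_le_of_le_one (D.valL_coeff_le hf hi) (pow_le_one₀ zero_le hx)) (hc i)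

theorem IterateDatum.valL_π_step {n : ℕ} (h : (p : ℝ≥0)⁻¹ ≤ valL K L (D.π n)) :
    valL K L (D.π (n + 1)) ^ p = valL K L (D.π n) := by
  have h1 := D.iter n
  rw [D.eval₂_f] at h1
  have h2 := D.valL_sum_le hf (D.π (n + 1)) (D.valL_π_le_one _) (fun _ => 1) (C := 1) (by simp)
  simp only [mul_one] at h2
  have h3 := h2.trans_lt ((pow_lt_self_of_lt_one₀ inv_p_pos inv_p_lt_one one_lt_two).trans_le h)
  rw [← map_pow, eq_sub_of_add_eq h1, Valuation.map_sub_eq_of_lt_left _ h3]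

theorem IterateDatum.le_valL_π (n : ℕ) : (p : ℝ≥0)⁻¹ ≤ valL K L (D.π n) := by
  induction n with
  | zero => exact D.le_valL_π_zero
  | succ n ih =>
    refine ih.trans ?_
    rw [← D.valL_π_step hf ih]
    exact pow_le_of_le_one zero_le (D.valL_π_le_one _) (Fact.out : p.Prime).ne_zero

theorem IterateDatum.valL_π_pow (n : ℕ) : valL K L (D.π (n + 1)) ^ p = valL K L (D.π n) :=
  D.valL_π_step hf (D.le_valL_π hf n)

theorem IterateDatum.π_ne_zero (n : ℕ) : D.π n ≠ 0 := by
  intro h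
  have := D.le_valL_π hf n
  rw [h, map_zero] at this
  exact absurd this (not_le.2 inv_p_pos)

/-- `v_R(π̲) = v_p(π_0) ≤ 1`. -/
theorem IterateDatum.le_valR_πR : (p : ℝ≥0)⁻¹ ≤ valR p K L D.πR := by
  -- The component of index `0` vanishes if `π_0` and `p` are associated; the next one does not.
  have h1 : PreTilt.coeff 1 D.πR ≠ 0 := by
    rw [IterateDatum.πR, coeff_preTiltMk, Ne, ← valL_intL_le_inv_iff, not_le]
    refine lt_of_pow_lt_pow_left₀ p zero_le ?_
    change _ < valL K L (D.π (0 + 1)) ^ p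
    rw [D.valL_π_pow hf]
    exact (pow_lt_self_of_lt_one₀ inv_p_pos inv_p_lt_one (Fact.out : p.Prime).one_lt).trans_le
      (D.le_valL_π hf 0)
  rw [valR_eq p K L D.πR 1 h1 (D.πInt 1) rfl, pow_one]
  change _ ≤ valL K L (D.π (0 + 1)) ^ p
  rw [D.valL_π_pow hf]
  exact D.le_valL_π hf 0

theorem IterateDatum.πR_ne_zero : D.πR ≠ 0 := by
  intro h
  have := D.le_valR_πR hf
  rw [h, map_zero] at this
  exact absurd this (not_le.2 inv_p_pos)

/-- Since `f(π_{n+1}) = π_n` and `f(g π_{n+1}) = g π_n`, the quotients `y_n = g π_n / π_n` satisfy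
`(y_{n+1} ^ p - y_n) π_{n+1} ^ p = ∑ a_i π_{n+1} ^ i (y_n - y_{n+1} ^ i)`. As `v_p(a_i) ≥ 2` and
`v_p(π_{n+1} ^ p) ≤ 1`, this bounds `y_{n+1} ^ p - y_n`. -/
theorem IterateDatum.valL_quot_pow_sub_le (g : L ≃ₐ[K] L) (n : ℕ) {C : ℝ≥0}
    (hC : ∀ i, valL K L (g (D.π n) / D.π n - (g (D.π (n + 1)) / D.π (n + 1)) ^ (i + 1)) ≤ C) :
    valL K L ((g (D.π (n + 1)) / D.π (n + 1)) ^ p - g (D.π n) / D.π n) ≤ (p : ℝ≥0)⁻¹ * C := by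
  have hx0 := D.π_ne_zero hf (n + 1)
  have hn0 := D.π_ne_zero hf n
  set x := D.π (n + 1) with hx
  set y := g x / x with hy
  set w := g (D.π n) / D.π n with hw
  have h1 : x ^ p + ∑ i ∈ Finset.range (p - 1), zpToL p K L (D.f.coeff (i + 1)) * x ^ (i + 1)
      = D.π n := by
    rw [← D.eval₂_f]; exact D.iter n
  have hgx : g x = y * x := by rw [hy, div_mul_cancel₀ _ hx0]
  have h2 : (y * x) ^ p + ∑ i ∈ Finset.range (p - 1),
      zpToL p K L (D.f.coeff (i + 1)) * (y * x) ^ (i + 1) = w * D.π n := by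
    have := congrArg g h1
    rw [map_add, map_sum, map_pow] at this
    rw [hw, div_mul_cancel₀ _ hn0, ← this, hgx]
    refine congrArg _ (Finset.sum_congr rfl fun i _ => ?_)
    rw [map_mul, map_pow, hgx]
    congr 1
    exact (g.commutes _).symm
  have h3 : (y ^ p - w) * x ^ p = ∑ i ∈ Finset.range (p - 1),
      zpToL p K L (D.f.coeff (i + 1)) * x ^ (i + 1) * (w - y ^ (i + 1)) := by
    rw [← h1, mul_add, Finset.mul_sum] at h2
    have h4 : ∑ i ∈ Finset.range (p - 1),
        zpToL p K L (D.f.coeff (i + 1)) * x ^ (i + 1) * (w - y ^ (i + 1))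
        = ∑ i ∈ Finset.range (p - 1), w * (zpToL p K L (D.f.coeff (i + 1)) * x ^ (i + 1))
        - ∑ i ∈ Finset.range (p - 1), zpToL p K L (D.f.coeff (i + 1)) * (y * x) ^ (i + 1) := by
      rw [← Finset.sum_sub_distrib]
      exact Finset.sum_congr rfl fun i _ => by ring
    rw [h4]
    linear_combination h2
  have h5 := D.valL_sum_le hf x (D.valL_π_le_one _) (fun i => w - y ^ (i + 1)) hC
  rw [← h3, map_mul, map_pow, D.valL_π_pow hf] at h5
  have h6 := (mul_le_mul_right (D.le_valL_π hf n) (valL K L (y ^ p - w))).trans h5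
  rw [mul_comm, pow_two, mul_assoc] at h6
  exact le_of_mul_le_mul_left h6 inv_p_pos

theorem IterateDatum.quot_mem (g : L ≃ₐ[K] L) (n : ℕ) : g (D.π n) / D.π n ∈ intL K L := by
  change valL K L _ ≤ 1
  rw [map_div₀, valL_galois, div_self]
  rw [Ne, _root_.map_eq_zero]
  exact D.π_ne_zero hf n

/-- `v_p(g(π_n) / π_n - 1) ≥ p / (p ^ n (p - 1))`. -/
theorem IterateDatum.valL_quot_sub_one_le (g : L ≃ₐ[K] L) (n : ℕ) :
    valL K L (g (D.π n) / D.π n - 1) ^ (p ^ n * (p - 1)) ≤ (p : ℝ≥0)⁻¹ ^ p := by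
  have hp := (Fact.out : p.Prime)
  have hp1 : p - 1 ≠ 0 := Nat.sub_ne_zero_of_lt hp.one_lt
  induction n with
  | zero =>
    obtain ⟨ϖ, -, h⟩ := D.unif
    have h1 : g (D.π 0) / D.π 0 - 1 = 0 := by
      rw [sub_eq_zero, div_eq_one_iff_eq (D.π_ne_zero hf 0), ← h]
      exact g.commutes _
    rw [h1, map_zero, zero_pow (by simpa using hp1)]
    exact zero_le
  | succ n ih =>
    set w : intL K L := ⟨_, D.quot_mem hf g n⟩ with hw
    set y : intL K L := ⟨_, D.quot_mem hf g (n + 1)⟩ with hy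
    set z : intL K L := y - 1 with hz
    change valL K L (z : L) ^ _ ≤ _
    change valL K L ((w - 1 : intL K L) : L) ^ _ ≤ _ at ih
    have hz1 : valL K L z ≤ 1 := z.2
    have hyz : ∀ i, valL K L ((w - y ^ (i + 1) : intL K L) : L)
        ≤ max (valL K L ((w - 1 : intL K L) : L)) (valL K L z) := by
      intro i
      obtain ⟨t, ht⟩ := sub_one_dvd_pow_sub_one y (i + 1)
      have : w - y ^ (i + 1) = (w - 1) - z * t := by rw [hz, ← ht]; ring
      rw [this]
      refine ((valL K L).map_sub _ _).trans (max_le_max le_rfl ?_)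
      change valL K L ((z : L) * t) ≤ _
      rw [map_mul]
      exact mul_le_of_le_one_right zero_le t.2
    have h1 : valL K L ((y ^ p - w : intL K L) : L) ≤ _ := D.valL_quot_pow_sub_le hf g n hyz
    obtain ⟨r, hr⟩ := exists_add_pow_prime_eq hp 1 z
    have h2 : z ^ p = (y ^ p - w) + (w - 1) - p * z * r := by
      have : y = 1 + z := by rw [hz]; ring
      rw [this, hr]; ring
    have h3 : valL K L z ^ p
        ≤ max (valL K L ((w - 1 : intL K L) : L)) ((p : ℝ≥0)⁻¹ * valL K L z) := by
      have h4 : valL K L ((z : L)) ^ p = valL K L ((z ^ p : intL K L) : L) := by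
        rw [← map_pow]; rfl
      rw [h4, h2]
      refine ((valL K L).map_sub _ _).trans (max_le (((valL K L).map_add _ _).trans
        (max_le (h1.trans ?_) (le_max_left _ _))) (le_max_of_le_right ?_))
      · rw [mul_max]
        exact max_le_max (mul_le_of_le_one_left zero_le inv_p_lt_one.le) le_rfl
      · change valL K L ((p : L) * z * r) ≤ _
        rw [map_mul, map_mul, valL_p]
        exact mul_le_of_le_one_right zero_le r.2
    rcases le_max_iff.1 h3 with h4 | h4
    · calc _ = (valL K L (z : L) ^ p) ^ (p ^ n * (p - 1)) := by
            rw [← pow_mul]; congr 1; ring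
        _ ≤ _ := (pow_le_pow_left₀ zero_le h4 _).trans ih
    · by_cases hz0 : valL K L (z : L) = 0
      · rw [hz0, zero_pow (mul_ne_zero (pow_ne_zero _ hp.ne_zero) hp1)]
        exact zero_le
      have h5 : valL K L (z : L) ^ (p - 1) ≤ (p : ℝ≥0)⁻¹ := by
        rw [← pow_sub_one_mul hp.ne_zero] at h4
        exact le_of_mul_le_mul_right h4 (pos_iff_ne_zero.2 hz0)
      calc _ = (valL K L (z : L) ^ (p - 1)) ^ (p ^ (n + 1)) := by
            rw [← pow_mul, mul_comm]
        _ ≤ (p : ℝ≥0)⁻¹ ^ p ^ (n + 1) := pow_le_pow_left₀ zero_le h5 _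
        _ ≤ _ := pow_le_pow_of_le_one zero_le inv_p_lt_one.le
          (Nat.le_self_pow (Nat.succ_ne_zero n) p)

/-- `g(π̲) = χ π̲` with `v_R(χ - 1) ≥ p / (p - 1)`: the element `χ` of `R` has the components
`g(π_n) / π_n`. -/
theorem IterateDatum.exists_galR_πR (g : L ≃ₐ[K] L) :
    ∃ χ : RR p K L, galR p K L g D.πR = χ * D.πR ∧ valR p K L (χ - 1) ^ (p - 1) ≤ (p : ℝ≥0)⁻¹ ^ p := by
  let y : ℕ → intL K L := fun n => ⟨_, D.quot_mem hf g n⟩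
  refine ⟨preTiltMk (fun n => Ideal.Quotient.mk _ (y n)) fun n => ?_, preTilt_ext fun n => ?_, ?_⟩
  · have h1 := D.valL_quot_pow_sub_le hf g n (C := 1) fun i => (y n - y (n + 1) ^ (i + 1)).2
    rw [mul_one] at h1
    rw [← map_pow, ← sub_eq_zero, ← map_sub]
    exact valL_intL_le_inv_iff.1 h1
  · rw [coeff_galR, map_mul, coeff_preTiltMk, IterateDatum.πR, coeff_preTiltMk, galModP_mk]
    refine (congrArg (Ideal.Quotient.mk _) (Subtype.ext ?_)).trans (map_mul _ _ _)
    exact (div_mul_cancel₀ _ (D.π_ne_zero hf n)).symm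
  · set χ := preTiltMk (fun n => Ideal.Quotient.mk _ (y n)) _
    by_cases hχ : χ - 1 = 0
    · rw [hχ, map_zero, zero_pow (Nat.sub_ne_zero_of_lt (Fact.out : p.Prime).one_lt)]
      exact zero_le
    obtain ⟨n, hn⟩ := exists_coeff_ne_zero hχ
    rw [valR_eq p K L _ n hn (y n - 1) (by rw [map_sub, map_sub, map_one, map_one]; rfl), ← pow_mul]
    exact D.valL_quot_sub_one_le hf g n

end Iterate

/-! ### Frobenius systems and the cocycle -/

section Contraction
variable {p : ℕ} [Fact p.Prime]
variable {K : Type*} [NontriviallyNormedField K] [NormedAlgebra ℚ_[p] K] [IsUltrametricDist K]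
  [CompleteSpace K]
variable {L : Type*} [Field L] [Algebra K L] [Algebra.IsAlgebraic K L]

/-- Integral powers express the condition `v_R(x) ≥ p ^ k / (p - 1)`. -/
theorem mem_mR_div_iff {x : RR p K L} (k : ℕ) :
    x ∈ mR p K L ((p : ℝ) ^ k / ((p : ℝ) - 1)) ↔
      valR p K L x ^ (p - 1) ≤ (p : ℝ≥0)⁻¹ ^ p ^ k := by
  have hp := (Fact.out : p.Prime)
  have hp1 : p - 1 ≠ 0 := Nat.sub_ne_zero_of_lt hp.one_lt
  have h1 : ((p : ℝ≥0) ^ (-((p : ℝ) ^ k / ((p : ℝ) - 1)))) ^ (p - 1) = (p : ℝ≥0)⁻¹ ^ p ^ k := by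
    rw [← NNReal.rpow_natCast, ← NNReal.rpow_mul, Nat.cast_sub hp.one_le, Nat.cast_one, neg_mul,
      div_mul_cancel₀, NNReal.rpow_neg, inv_pow, ← NNReal.rpow_natCast _ (p ^ k), Nat.cast_pow]
    have : (1 : ℝ) < p := by exact_mod_cast hp.one_lt
    linarith
  rw [mem_mR, ← h1]
  exact (pow_le_pow_iff_left₀ zero_le zero_le hp1).symm

theorem one_le_sq_div : (1 : ℝ) ≤ (p : ℝ) ^ 2 / ((p : ℝ) - 1) := by
  have : (1 : ℝ) < p := by exact_mod_cast (Fact.out : p.Prime).one_lt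
  rw [le_div_iff₀ (by linarith)]
  nlinarith

theorem valR_le_inv_of_mem_mR {c : ℝ} (hc : 1 ≤ c) {x : RR p K L} (hx : x ∈ mR p K L c) :
    valR p K L x ≤ (p : ℝ≥0)⁻¹ := by
  refine (mem_mR.1 hx).trans ?_
  rw [← NNReal.rpow_neg_one]
  exact NNReal.rpow_le_rpow_of_exponent_le (by exact_mod_cast (Fact.out : p.Prime).one_le)
    (by linarith)

/-- The ideals `𝔪_R^{≥ c}` are open, hence closed: elements of `R` that vanish in a component of
large index lie in `𝔪_R^{≥ c}`. -/
theorem exists_mem_mR_of_coeff_eq_zero (c : ℝ) :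
    ∃ N, ∀ x : RR p K L, PreTilt.coeff N x = 0 → x ∈ mR p K L c := by
  have hp : 1 < p := (Fact.out : p.Prime).one_lt
  obtain ⟨N, hN⟩ := exists_nat_ge c
  refine ⟨N, fun x hx => (valR_le_of_coeff_eq_zero hx).trans ?_⟩
  rw [NNReal.rpow_neg, inv_pow, ← NNReal.rpow_natCast]
  refine inv_anti₀ (NNReal.rpow_pos (by exact_mod_cast (by omega : 0 < p))) ?_
  refine NNReal.rpow_le_rpow_of_exponent_le (by exact_mod_cast hp.le) (hN.trans ?_)
  exact_mod_cast (Nat.lt_pow_self hp).le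

theorem mul_sub_one_mem {A : Type*} [CommRing A] {I : Ideal A} {a b : A} (ha : a - 1 ∈ I)
    (hb : b - 1 ∈ I) : a * b - 1 ∈ I := by
  have : a * b - 1 = b * (a - 1) + (b - 1) := by ring
  rw [this]
  exact I.add_mem (I.mul_mem_left _ ha) hb

theorem pow_sub_one_mem {A : Type*} [CommRing A] {I : Ideal A} {a : A} (ha : a - 1 ∈ I) (m : ℕ) :
    a ^ m - 1 ∈ I := by
  obtain ⟨t, ht⟩ := sub_one_dvd_pow_sub_one a m
  rw [ht]
  exact I.mul_mem_right _ ha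

/-- A solution in `R` of the system `x_{i+1} = ζ_i x_i ^ p` over `ℤ/d` with `v_R(x_i) ≥ 1`
vanishes, as `v_R(x_{i+1}) ≥ p v_R(x_i)`. -/
theorem eq_zero_of_frobenius_system {d : ℕ} {ζ x : ZMod d → RR p K L}
    (hx : ∀ i, valR p K L (x i) ≤ (p : ℝ≥0)⁻¹) (h : ∀ i, x (i + 1) = ζ i * x i ^ p) (i : ZMod d) :
    x i = 0 := by
  have key : ∀ k i, valR p K L (x i) ≤ (p : ℝ≥0)⁻¹ ^ p ^ k := by
    intro k
    induction k with
    | zero => simpa using hx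
    | succ k ih =>
      intro i
      have h1 := h (i - 1)
      rw [sub_add_cancel] at h1
      rw [h1, map_mul, map_pow, pow_succ, pow_mul]
      exact mul_le_of_le_one_of_le (valR_le_one p K L _) (pow_le_pow_left₀ zero_le (ih _) _)
  exact preTilt_ext fun k => by rw [coeff_eq_zero_of_valR_le (key k i), map_zero]

theorem sub_frobenius_system {d : ℕ} {ζ a b : ZMod d → RR p K L}
    (ha : ∀ i, a (i + 1) = ζ i * a i ^ p) (hb : ∀ i, b (i + 1) = ζ i * b i ^ p) (i : ZMod d) :
    a (i + 1) - b (i + 1) = ζ i * (a i - b i) ^ p := by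
  rw [ha, hb, sub_pow_char, mul_sub]

/-- The system `a_{i+1} = ζ_i a_i ^ p` has at most one solution in `1 + 𝔪_R^{≥ c}`. -/
theorem frobenius_system_unique {c : ℝ} (hc : 1 ≤ c) {d : ℕ} {ζ a b : ZMod d → RR p K L}
    (ha : ∀ i, a (i + 1) = ζ i * a i ^ p) (hb : ∀ i, b (i + 1) = ζ i * b i ^ p)
    (ha1 : ∀ i, a i - 1 ∈ mR p K L c) (hb1 : ∀ i, b i - 1 ∈ mR p K L c) : a = b := by
  funext i
  rw [← sub_eq_zero]
  refine eq_zero_of_frobenius_system (x := fun i => a i - b i)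
    (fun i => valR_le_inv_of_mem_mR hc ?_) (sub_frobenius_system ha hb) i
  have := (mR p K L c).sub_mem (ha1 i) (hb1 i)
  rwa [sub_sub_sub_cancel_right] at this

/-- The system `a_{i+1} = ζ_i a_i ^ p` with `ζ_i ∈ 1 + 𝔪_R^{≥ c}` has a solution in
`1 + 𝔪_R^{≥ c}`: the right hand side is a contraction. -/
theorem exists_frobenius_system {c : ℝ} (hc : 1 ≤ c) {d : ℕ} {ζ : ZMod d → RR p K L}
    (hζ : ∀ i, ζ i - 1 ∈ mR p K L c) :
    ∃ a : ZMod d → RR p K L, (∀ i, a i - 1 ∈ mR p K L c) ∧ ∀ i, a (i + 1) = ζ i * a i ^ p := by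
  let F : (ZMod d → RR p K L) → ZMod d → RR p K L := fun a i => ζ (i - 1) * a (i - 1) ^ p
  let s : ℕ → ZMod d → RR p K L := fun k => F^[k] 1
  have hs : ∀ k, s (k + 1) = F (s k) := fun k => Function.iterate_succ_apply' F k 1
  have h1 : ∀ k i, s k i - 1 ∈ mR p K L c := by
    intro k
    induction k with
    | zero => simp [s]
    | succ k ih =>
      intro i
      rw [hs]
      exact mul_sub_one_mem (hζ _) (pow_sub_one_mem (ih _) p)
  have h2 : ∀ k i, valR p K L (s (k + 1) i - s k i) ≤ (p : ℝ≥0)⁻¹ ^ p ^ k := by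
    intro k
    induction k with
    | zero =>
      intro i
      rw [pow_zero, pow_one]
      exact valR_le_inv_of_mem_mR hc (by simpa [s] using h1 1 i)
    | succ k ih =>
      intro i
      have : s (k + 1 + 1) i - s (k + 1) i = ζ (i - 1) * (s (k + 1) (i - 1) - s k (i - 1)) ^ p := by
        rw [sub_pow_char, mul_sub, hs (k + 1), hs k]
      rw [this, map_mul, map_pow, pow_succ, pow_mul]
      exact mul_le_of_le_one_of_le (valR_le_one p K L _) (pow_le_pow_left₀ zero_le (ih _) _)
  have h3 : ∀ k i, PreTilt.coeff k (s (k + 1) i) = PreTilt.coeff k (s k i) := fun k i => by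
    rw [← sub_eq_zero, ← map_sub]
    exact coeff_eq_zero_of_valR_le (h2 k i)
  refine ⟨fun i => preTiltMk (fun k => PreTilt.coeff k (s k i)) fun k => ?_, fun i => ?_,
    fun i => preTilt_ext fun k => ?_⟩
  · rw [PreTilt.coeff_pow_p, h3]
  · obtain ⟨N, hN⟩ := exists_mem_mR_of_coeff_eq_zero (p := p) (K := K) (L := L) c
    have := (mR p K L c).add_mem (h1 N i) (hN (preTiltMk (fun k => PreTilt.coeff k (s k i))
      (fun k => by rw [PreTilt.coeff_pow_p, h3]) - s N i) (by
        rw [map_sub, coeff_preTiltMk, sub_self]))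
    rwa [sub_add_sub_cancel'] at this
  · rw [map_mul, map_pow, coeff_preTiltMk, coeff_preTiltMk, ← h3, hs, ← map_pow, ← map_mul]
    simp only [F, add_sub_cancel_right]

end Contraction

section Cocycle
variable {p : ℕ} [Fact p.Prime]
variable {K : Type*} [NontriviallyNormedField K] [NormedAlgebra ℚ_[p] K] [IsUltrametricDist K]
  [CompleteSpace K] [IsDiscreteValuationRing (intK K)]
variable {L : Type*} [Field L] [Algebra K L] [Algebra.IsAlgebraic K L]
variable (D : IterateDatum p K L)
variable (hf : ∀ i ∈ Finset.Icc 1 (p - 1), ‖D.f.coeff i‖ < (p : ℝ)⁻¹)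
include hf

theorem IterateDatum.exists_galR_πR_pow (g : L ≃ₐ[K] L) :
    ∃ η : RR p K L, galR p K L g (D.πR ^ p) = η * D.πR ^ p ∧
      η - 1 ∈ mR p K L ((p : ℝ) ^ 2 / ((p : ℝ) - 1)) := by
  obtain ⟨χ, h1, h2⟩ := D.exists_galR_πR hf g
  refine ⟨χ ^ p, by rw [map_pow, h1, mul_pow], ?_⟩
  rw [mem_mR_div_iff]
  have : χ ^ p - 1 = (χ - 1) ^ p := by rw [sub_pow_char, one_pow]
  rw [this, map_pow, ← pow_mul, mul_comm, pow_mul, pow_two p, pow_mul]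
  exact pow_le_pow_left₀ zero_le h2 _

/-- The matrix entries of the action: elements `a_i(g)` of `1 + 𝔪_R^{≥ p² / (p - 1)}` with
`g(π̲ ^ p) ^ nᵢ a_{i+1}(g) = a_i(g) ^ p π̲ ^ (p nᵢ)` that form a `1`-cocycle, trivial on the
stabilizer of `π̲`. -/
theorem IterateDatum.exists_cocycle {d : ℕ} (n : ZMod d → ℕ) :
    ∃ a : (L ≃ₐ[K] L) → ZMod d → RR p K L,
      (∀ g i, a g i - 1 ∈ mR p K L ((p : ℝ) ^ 2 / ((p : ℝ) - 1))) ∧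
      (∀ g i, galR p K L g (D.πR ^ p) ^ n i * a g (i + 1) = a g i ^ p * (D.πR ^ p) ^ n i) ∧
      (∀ g h i, a (g * h) i = a g i * galR p K L g (a h i)) ∧
      ∀ g, galR p K L g D.πR = D.πR → ∀ i, a g i = 1 := by
  choose η hη hη1 using D.exists_galR_πR_pow hf
  have hπ : D.πR ^ p ≠ 0 := pow_ne_zero _ (D.πR_ne_zero hf)
  have hηmul : ∀ g h, η (g * h) = η g * galR p K L g (η h) := by
    intro g h
    apply mul_right_cancel₀ hπ
    rw [← hη, galR_mul, hη h, map_mul, hη g]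
    ring
  have hη_one : ∀ g, galR p K L g D.πR = D.πR → η g = 1 := by
    intro g hg
    apply mul_right_cancel₀ hπ
    rw [← hη, one_mul, map_pow, hg]
  -- The inverse of `η g` is `g (η g⁻¹)`.
  let ζ : (L ≃ₐ[K] L) → RR p K L := fun g => galR p K L g (η g⁻¹)
  have hζ : ∀ g, η g * ζ g = 1 := fun g => by
    rw [← hηmul, mul_inv_cancel]
    exact hη_one 1 (galR_one _)
  have hζ1 : ∀ g, ζ g - 1 ∈ mR p K L ((p : ℝ) ^ 2 / ((p : ℝ) - 1)) := fun g => by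
    have := galR_mem_mR g (hη1 g⁻¹)
    rwa [map_sub, map_one] at this
  have hζmul : ∀ g h, ζ (g * h) = ζ g * galR p K L g (ζ h) := by
    intro g h
    have h1 : galR p K L g (η h) * galR p K L g (ζ h) = 1 := by rw [← map_mul, hζ, map_one]
    have h2 := hζ (g * h)
    rw [hηmul] at h2
    linear_combination (ζ g * galR p K L g (ζ h)) * h2
      - ζ (g * h) * galR p K L g (η h) * galR p K L g (ζ h) * hζ g - ζ (g * h) * h1
  choose a ha1 ha using fun g => exists_frobenius_system (p := p) (K := K) (L := L)
    (one_le_sq_div (p := p)) (ζ := fun i : ZMod d => ζ g ^ n i)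
    fun i => pow_sub_one_mem (hζ1 g) (n i)
  refine ⟨a, ha1, fun g i => ?_, fun g h i => ?_, fun g hg i => ?_⟩
  · rw [hη, ha, mul_pow]
    have : η g ^ n i * ζ g ^ n i = 1 := by rw [← mul_pow, hζ, one_pow]
    linear_combination (D.πR ^ p) ^ n i * a g i ^ p * this
  · refine congrFun (frobenius_system_unique one_le_sq_div (ha (g * h))
      (b := fun i => a g i * galR p K L g (a h i)) (fun i => ?_) (ha1 (g * h)) fun i => ?_) i
    · rw [ha, ha, hζmul, map_mul, map_pow, map_pow]
      ring
    · have := galR_mem_mR g (ha1 h i)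
      rw [map_sub, map_one] at this
      exact mul_sub_one_mem (ha1 g i) this
  · refine congrFun (frobenius_system_unique one_le_sq_div (ha g) (b := fun _ => 1) (fun i => ?_)
      (ha1 g) fun i => ?_) i
    · have := hζ g
      rw [hη_one g hg, one_mul] at this
      rw [this, one_pow, one_pow, one_mul]
    · rw [sub_self]; exact zero_mem _

/-- A family `b_{ij}` in `𝔪_R^{≥ p² / (p - 1)}` with
`g(π̲ ^ p) ^ nᵢ b_{i+1,j+1} = b_{ij} ^ p π̲ ^ (p nⱼ)` vanishes if `nᵢ ≤ p - 1`: as `v_R(π̲) ≤ 1`,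
passing from `b_{ij}` to `b_{i+1,j+1}` increases the valuation by at least `p`. -/
theorem IterateDatum.eq_zero_of_intertwining {d : ℕ} (n : ZMod d → ℕ) (hn : ∀ i, n i ≤ p - 1)
    (g : L ≃ₐ[K] L) (b : ZMod d → ZMod d → RR p K L)
    (hb : ∀ i j, b i j ∈ mR p K L ((p : ℝ) ^ 2 / ((p : ℝ) - 1)))
    (h : ∀ i j, galR p K L g (D.πR ^ p) ^ n i * b (i + 1) (j + 1)
      = b i j ^ p * (D.πR ^ p) ^ n j) (i j : ZMod d) : b i j = 0 := by
  have hp := (Fact.out : p.Prime)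
  set q : ℝ≥0 := (p : ℝ≥0)⁻¹ with hq
  have hq0 : 0 < q := inv_p_pos
  have hq1 : q < 1 := inv_p_lt_one
  have step : ∀ i j, valR p K L (b (i + 1) (j + 1)) ≤ q ^ p * valR p K L (b i j) := by
    intro i j
    have h1 := congrArg (valR p K L) (h i j)
    rw [map_mul, map_mul, map_pow, valR_galR, map_pow, map_pow] at h1
    have h2 : q ^ (p * (p - 1)) ≤ (valR p K L D.πR ^ p) ^ n i := by
      rw [← pow_mul]
      exact (pow_le_pow_of_le_one zero_le hq1.le (Nat.mul_le_mul_left p (hn i))).trans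
        (pow_le_pow_left₀ zero_le (D.le_valR_πR hf) _)
    have h3 : valR p K L (b i j) ^ p ≤ q ^ p ^ 2 * valR p K L (b i j) := by
      rw [← pow_sub_one_mul hp.ne_zero]
      exact mul_le_mul_left ((mem_mR_div_iff 2).1 (hb i j)) _
    have h4 : q ^ (p * (p - 1)) * valR p K L (b (i + 1) (j + 1))
        ≤ q ^ (p * (p - 1)) * (q ^ p * valR p K L (b i j)) := by
      refine (mul_le_mul_left h2 _).trans ?_
      rw [h1, ← mul_assoc, ← pow_add, ← Nat.mul_succ, Nat.succ_eq_add_one,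
        Nat.sub_add_cancel hp.one_le, ← pow_two]
      exact (mul_le_of_le_one_right zero_le (valR_le_one p K L _)).trans h3
    exact le_of_mul_le_mul_left h4 (pow_pos hq0 _)
  have iter : ∀ k i j, valR p K L (b i j) ≤ (q ^ p) ^ k := by
    intro k
    induction k with
    | zero => intro i j; rw [pow_zero]; exact valR_le_one p K L _
    | succ k ih =>
      intro i j
      have := step (i - 1) (j - 1)
      rw [sub_add_cancel, sub_add_cancel] at this
      rw [pow_succ']
      exact this.trans (mul_le_mul_right (ih _ _) _)
  by_contra h0
  obtain ⟨k, hk⟩ := exists_pow_lt_of_lt_one (pos_iff_ne_zero.2 (mt valR_eq_zero.1 h0))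
    (pow_lt_one₀ zero_le hq1 hp.ne_zero)
  exact absurd (iter k i j) (not_le.2 hk)

end Cocycle

/-! ### Coordinates on the tensor product and the action -/

section Coordinates
variable {p : ℕ} [Fact p.Prime]
variable {K : Type*} [NontriviallyNormedField K] [NormedAlgebra ℚ_[p] K] [IsUltrametricDist K]
  [CompleteSpace K] [IsDiscreteValuationRing (intK K)] [CharP (resK K) p] [PerfectField (resK K)]
variable {L : Type*} [Field L] [Algebra K L] [Algebra.IsAlgebraic K L]
variable (D : IterateDatum p K L)

/-- Reduction modulo `p`, `W(R) → R`. -/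
def WPhi.red : WPhi D →+* RR p K L :=
  (WittVector.constantCoeff : WittVector p (RR p K L) →+* RR p K L)

theorem WPhi.red_surjective : Function.Surjective (WPhi.red D) := fun x =>
  ⟨WittVector.teichmuller p x, WittVector.teichmuller_coeff_zero p x⟩

theorem WPhi.exists_eq_p_mul_of_red_eq_zero {a : WPhi D} (h : WPhi.red D a = 0) :
    ∃ b : WPhi D, a = (p : WPhi D) * b :=
  Ideal.mem_span_singleton.1 ((WittVector.mem_span_p_iff_coeff_zero_eq_zero (p := p) a).2 h)

theorem WPhi.red_frob (a : WPhi D) : WPhi.red D (WPhi.frob D a) = WPhi.red D a ^ p :=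
  WittVector.coeff_frobenius_charP p a 0

theorem WPhi.red_gal (g : L ≃ₐ[K] L) (a : WPhi D) :
    WPhi.red D (WPhi.gal D g a) = galR p K L g (WPhi.red D a) :=
  WittVector.map_coeff (galR p K L g) a 0

theorem redS_surjective : Function.Surjective (redS p K) :=
  PowerSeries.map_surjective _ (WittVector.constantCoeff_surjective p)

theorem exists_eq_p_mul_of_redS_eq_zero {s : SS p K} (h : redS p K s = 0) :
    ∃ t : SS p K, s = (p : SS p K) * t := by
  have h1 : ∀ i, ∃ t : WittVector p (resK K), coeff i s = (p : WittVector p (resK K)) * t :=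
    fun i => by
      refine Ideal.mem_span_singleton.1
        ((WittVector.mem_span_p_iff_coeff_zero_eq_zero (p := p) (coeff i s)).2 ?_)
      have := congrArg (coeff i) h
      rwa [redS, PowerSeries.coeff_map, map_zero] at this
  choose t ht using h1
  refine ⟨PowerSeries.mk t, PowerSeries.ext fun i => ?_⟩
  rw [ht, ← map_natCast (C (R := WittVector p (resK K))), coeff_C_mul, coeff_mk]

/-- The map `k⟦u⟧ → R` induced by `φ : 𝔖 → 𝔖 ⊆ W(R)` modulo `p`; it sends `u` to `π̲ ^ p`. -/
def IterateDatum.evalPow : (resK K)⟦X⟧ →+* RR p K L :=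
  RingHom.liftOfSurjective (redS p K) redS_surjective
    ⟨(WPhi.red D).comp (algebraMap (SS p K) (WPhi D)), fun s hs => by
      obtain ⟨t, rfl⟩ := exists_eq_p_mul_of_redS_eq_zero (RingHom.mem_ker.1 hs)
      rw [RingHom.mem_ker, map_mul, map_natCast, CharP.cast_eq_zero, zero_mul]⟩

theorem IterateDatum.evalPow_redS (s : SS p K) :
    D.evalPow (redS p K s) = WPhi.red D (algebraMap (SS p K) (WPhi D) s) :=
  RingHom.liftOfRightInverse_comp_apply _ _ _ _ _

theorem IterateDatum.evalPow_redS_eq_pow (s : SS p K) :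
    D.evalPow (redS p K s) = WPhi.red D (WPhi.ofS D s) ^ p := by
  rw [D.evalPow_redS, ← WPhi.red_frob]
  exact congrArg (WPhi.red D) (D.emb_frobS s)

theorem IterateDatum.evalPow_X : D.evalPow X = D.πR ^ p := by
  have h := D.evalPow_redS_eq_pow X
  rw [redS, PowerSeries.map_X] at h
  rw [h]
  refine congrArg (· ^ p) ?_
  change (D.emb X).coeff 0 = D.πR
  rw [D.emb_X, IterateDatum.πW, fSection_coeff_zero]

theorem IterateDatum.galR_evalPow_C (g : L ≃ₐ[K] L) (c : resK K) :
    galR p K L g (D.evalPow (C c)) = D.evalPow (C c) := by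
  have h : redS p K (C (WittVector.teichmuller p c)) = C c := by
    rw [redS, PowerSeries.map_C]
    exact congrArg C (WittVector.teichmuller_coeff_zero p c)
  rw [← h, D.evalPow_redS_eq_pow, map_pow]
  refine congrArg (· ^ p) ?_
  have h2 : WPhi.red D (WPhi.ofS D (C (WittVector.teichmuller p c))) = resToR p K L c := by
    change (D.emb (C (WittVector.teichmuller p c))).coeff 0 = _
    rw [D.emb_C, WittVector.map_coeff, WittVector.teichmuller_coeff_zero]
  rw [h2, galR_resToR]

/-- A congruence `g(π̲ ^ p) ≡ π̲ ^ p` modulo an open ideal propagates to all power series in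
`π̲ ^ p`. -/
theorem IterateDatum.galR_evalPow_sub_mem (g : L ≃ₐ[K] L) (I : Ideal (RR p K L)) {N : ℕ}
    (hI : ∀ x : RR p K L, PreTilt.coeff N x = 0 → x ∈ I)
    (hg : galR p K L g (D.πR ^ p) - D.πR ^ p ∈ I) (t : (resK K)⟦X⟧) :
    galR p K L g (D.evalPow t) - D.evalPow t ∈ I := by
  rw [← Ideal.Quotient.eq]
  refine RingHom.congr_fun (f := ((Ideal.Quotient.mk I).comp (galR p K L g)).comp D.evalPow)
    (g := (Ideal.Quotient.mk I).comp D.evalPow)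
    (powerSeries_hom_ext (J := fun _ => ⊥) (fun x hx => hx 0) _ _ (fun c => ?_) ?_ fun _ => ?_) t
  · exact congrArg _ (D.galR_evalPow_C g c)
  · change Ideal.Quotient.mk I (galR p K L g (D.evalPow X)) = Ideal.Quotient.mk I (D.evalPow X)
    rw [D.evalPow_X]
    exact Ideal.Quotient.eq.2 hg
  · obtain ⟨M, hM⟩ := D.coeff_πR_pow N
    refine ⟨M, ?_⟩
    change Ideal.Quotient.mk I (galR p K L g (D.evalPow X)) ^ M = 0
    rw [D.evalPow_X, ← map_pow, ← map_pow, Ideal.Quotient.eq_zero_iff_mem]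
    refine hI _ ?_
    rw [coeff_galR, ← pow_mul, mul_comm, pow_mul, map_pow, map_pow (PreTilt.coeff N) D.πR, hM,
      zero_pow (Fact.out : p.Prime).ne_zero, map_zero]

theorem IterateDatum.galR_evalPow (g : L ≃ₐ[K] L) (hg : galR p K L g D.πR = D.πR)
    (t : (resK K)⟦X⟧) : galR p K L g (D.evalPow t) = D.evalPow t := by
  rw [← sub_eq_zero]
  refine preTilt_ext fun N => ?_
  rw [map_zero]
  refine RingHom.mem_ker.1 (D.galR_evalPow_sub_mem g (RingHom.ker (PreTilt.coeff N)) (N := N)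
    (fun x hx => hx) ?_ t)
  rw [map_pow, hg, sub_self]
  exact zero_mem _

theorem IterateDatum.galR_red_ofS (g : L ≃ₐ[K] L) (hg : galR p K L g D.πR = D.πR) (s : SS p K) :
    galR p K L g (WPhi.red D (WPhi.ofS D s)) = WPhi.red D (WPhi.ofS D s) := by
  have h := D.galR_evalPow g hg (redS p K s)
  rw [D.evalPow_redS_eq_pow, map_pow] at h
  exact frobenius_inj (RR p K L) p h

theorem IterateDatum.galR_πR_of_mem_galPi {g : L ≃ₐ[K] L} (hg : g ∈ D.galPi) :
    galR p K L g D.πR = D.πR := by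
  refine preTilt_ext fun k => ?_
  rw [coeff_galR, IterateDatum.πR, coeff_preTiltMk, galModP_mk]
  refine congrArg _ (Subtype.ext ?_)
  exact (IntermediateField.mem_fixingSubgroup_iff _ _).1 hg (D.π k)
    (IntermediateField.subset_adjoin K _ ⟨k, rfl⟩)

variable {d : ℕ} [NeZero d] (n : ZMod d → ℕ)

theorem SimpleKisin.p_smul (x : SimpleKisin K n) : (p : SS p K) • x = 0 := by
  have : CharP (resK K)⟦X⟧ p := charP_of_injective_ringHom (f := C (R := resK K)) C_injective p
  funext i
  rw [SimpleKisin.smul_apply, map_natCast, CharP.cast_eq_zero, zero_mul]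
  rfl

/-- Since `p` kills `𝔐(𝔫)`, only the reduction of `a` modulo `p` matters in `a ⊗ x`. -/
theorem tmul_eq_zero_of_red_eq_zero {a : WPhi D} (h : WPhi.red D a = 0) (x : SimpleKisin K n) :
    a ⊗ₜ[SS p K] x = 0 := by
  obtain ⟨b, rfl⟩ := WPhi.exists_eq_p_mul_of_red_eq_zero D h
  have : (p : WPhi D) * b = (p : SS p K) • b := by rw [Algebra.smul_def, map_natCast]
  rw [this, smul_tmul, SimpleKisin.p_smul, tmul_zero]

/-- The coordinates `W(R) ⊗_{φ, 𝔖} 𝔐(𝔫) → R ^ d` with respect to the basis `1 ⊗ eᵢ`. -/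
def coordHom : PhiTensor D n →+ (ZMod d → RR p K L) :=
  TensorProduct.liftAddHom
    { toFun := fun a =>
        { toFun := fun x i => WPhi.red D a * D.evalPow (x i)
          map_zero' := by
            funext i
            change _ * D.evalPow 0 = 0
            rw [map_zero, mul_zero]
          map_add' := fun x y => by
            funext i
            change _ * D.evalPow (x i + y i) = _ * D.evalPow (x i) + _ * D.evalPow (y i)
            rw [map_add, mul_add] }
      map_zero' := by ext x; simp
      map_add' := fun a b => by ext x; simp [add_mul] }
    (fun s a x => by
      funext i
      change WPhi.red D (s • a) * D.evalPow (x i) = WPhi.red D a * D.evalPow ((s • x) i)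
      rw [Algebra.smul_def, SimpleKisin.smul_apply, map_mul, map_mul, D.evalPow_redS]
      ring)

theorem coordHom_tmul (a : WPhi D) (x : SimpleKisin K n) (i : ZMod d) :
    coordHom D n (a ⊗ₜ x) i = WPhi.red D a * D.evalPow (x i) := rfl

theorem coordHom_tmul_e (a : WPhi D) (i j : ZMod d) :
    coordHom D n (a ⊗ₜ SimpleKisin.e K n i) j = if j = i then WPhi.red D a else 0 := by
  rw [coordHom_tmul, SimpleKisin.e]
  by_cases h : j = i
  · subst h; rw [Pi.single_eq_same, map_one, mul_one, if_pos rfl]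
  · rw [Pi.single_eq_of_ne h, map_zero, mul_zero, if_neg h]

theorem coordHom_sum (c : ZMod d → WPhi D) (j : ZMod d) :
    coordHom D n (∑ i, c i ⊗ₜ SimpleKisin.e K n i) j = WPhi.red D (c j) := by
  rw [map_sum, Finset.sum_apply]
  simp only [coordHom_tmul_e, Finset.sum_ite_eq, Finset.mem_univ, if_true]

theorem SimpleKisin.phi_apply_add_one (x : SimpleKisin K n) (i : ZMod d) :
    SimpleKisin.phi p K n x (i + 1) = X ^ n i * x i ^ p := by
  have h : SimpleKisin.phi p K n x (i + 1) = X ^ n (i + 1 - 1) * x (i + 1 - 1) ^ p := rfl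
  rw [h, add_sub_cancel_right]

theorem SimpleKisin.exists_eq_sum (x : SimpleKisin K n) :
    ∃ s : ZMod d → SS p K, x = ∑ i, s i • SimpleKisin.e K n i := by
  choose s hs using fun i => redS_surjective (p := p) (K := K) (x i)
  refine ⟨s, ?_⟩
  have h : ∀ j, (∑ i, s i • SimpleKisin.e K n i) j = ∑ i, (s i • SimpleKisin.e K n i) j :=
    fun j => Finset.sum_apply (M := fun _ => (resK K)⟦X⟧) j Finset.univ _
  funext j
  rw [h, Finset.sum_eq_single j]
  · rw [SimpleKisin.smul_apply, SimpleKisin.e, Pi.single_eq_same, mul_one, hs]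
  · intro i _ hij
    rw [SimpleKisin.smul_apply, SimpleKisin.e, Pi.single_eq_of_ne hij.symm, mul_zero]
  · exact fun h => absurd (Finset.mem_univ j) h

theorem PhiTensor.exists_eq_sum (y : PhiTensor D n) :
    ∃ c : ZMod d → WPhi D, y = ∑ i, c i ⊗ₜ SimpleKisin.e K n i := by
  induction y using TensorProduct.induction_on with
  | zero => exact ⟨0, by simp⟩
  | tmul a x =>
    obtain ⟨s, rfl⟩ := SimpleKisin.exists_eq_sum (p := p) n x
    exact ⟨fun i => s i • a, by simp only [tmul_sum, smul_tmul]⟩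
  | add y z hy hz =>
    obtain ⟨c, rfl⟩ := hy
    obtain ⟨c', rfl⟩ := hz
    exact ⟨c + c', by simp only [Pi.add_apply, add_tmul, Finset.sum_add_distrib]⟩

theorem coordHom_bijective : Function.Bijective (coordHom D n) := by
  constructor
  · rw [injective_iff_map_eq_zero]
    intro y hy
    obtain ⟨c, rfl⟩ := PhiTensor.exists_eq_sum D n y
    refine Finset.sum_eq_zero fun i _ => tmul_eq_zero_of_red_eq_zero D n ?_ _
    rw [← coordHom_sum D n c i, hy, Pi.zero_apply]
  · intro v
    choose c hc using fun i => WPhi.red_surjective D (v i)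
    exact ⟨∑ i, c i ⊗ₜ SimpleKisin.e K n i, funext fun i => by rw [coordHom_sum, hc]⟩

/-- The identification of `W(R) ⊗_{φ, 𝔖} 𝔐(𝔫) = R ⊗_{φ, 𝔖} 𝔐(𝔫)` with `R ^ d` given by the basis
`1 ⊗ eᵢ`. -/
def coord : PhiTensor D n ≃+ (ZMod d → RR p K L) :=
  AddEquiv.ofBijective (coordHom D n) (coordHom_bijective D n)

theorem coord_tmul (a : WPhi D) (x : SimpleKisin K n) (i : ZMod d) :
    coord D n (a ⊗ₜ x) i = WPhi.red D a * D.evalPow (x i) := rfl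

theorem coord_smul (a : WPhi D) (y : PhiTensor D n) (i : ZMod d) :
    coord D n (a • y) i = WPhi.red D a * coord D n y i := by
  induction y using TensorProduct.induction_on with
  | zero => simp
  | tmul b x => rw [smul_tmul', coord_tmul, coord_tmul, smul_eq_mul, map_mul, mul_assoc]
  | add y z hy hz => rw [smul_add, map_add, map_add, Pi.add_apply, Pi.add_apply, hy, hz, mul_add]

/-- In coordinates, `φ` is `(vᵢ) ↦ (π̲ ^ (p nᵢ) vᵢ ^ p)_{i+1}`. -/
theorem coord_phiTensor (y : PhiTensor D n) (i : ZMod d) :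
    coord D n (phiTensor D n y) (i + 1) = (D.πR ^ p) ^ n i * coord D n y i ^ p := by
  induction y using TensorProduct.induction_on with
  | zero => simp [(Fact.out : p.Prime).ne_zero]
  | tmul a x =>
    rw [phiTensor_tmul, coord_tmul, coord_tmul, WPhi.red_frob]
    rw [SimpleKisin.phi_apply_add_one, map_mul, map_pow, map_pow, D.evalPow_X, mul_pow]
    exact mul_left_comm _ _ _
  | add y z hy hz =>
    rw [map_add, map_add, map_add, Pi.add_apply, Pi.add_apply, hy, hz, add_pow_char, mul_add]

theorem mem_mIdeal_smul_top_iff (c : ℝ) (y : PhiTensor D n) :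
    y ∈ WPhi.mIdeal D c • (⊤ : Submodule (WPhi D) (PhiTensor D n)) ↔
      ∀ i, coord D n y i ∈ mR p K L c := by
  constructor
  · intro hy i
    refine Submodule.smul_induction_on hy (fun a ha z _ => ?_) fun z w hz hw => ?_
    · rw [coord_smul]
      exact Ideal.mul_mem_right _ _ ha
    · rw [map_add]
      exact add_mem hz hw
  · intro h
    obtain ⟨a, rfl⟩ := PhiTensor.exists_eq_sum D n y
    refine Submodule.sum_mem _ fun i _ => ?_
    have h1 : a i ⊗ₜ[SS p K] SimpleKisin.e K n i
        = a i • ((1 : WPhi D) ⊗ₜ[SS p K] SimpleKisin.e K n i) := by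
      rw [smul_tmul', smul_eq_mul, mul_one]
    rw [h1]
    refine Submodule.smul_mem_smul ?_ trivial
    have h2 := h i
    change coordHom D n _ i ∈ _ at h2
    rwa [coordHom_sum] at h2

end Coordinates

section Action
variable {p : ℕ} [Fact p.Prime]
variable {K : Type*} [NontriviallyNormedField K] [NormedAlgebra ℚ_[p] K] [IsUltrametricDist K]
  [CompleteSpace K] [IsDiscreteValuationRing (intK K)] [CharP (resK K) p] [PerfectField (resK K)]
variable {L : Type*} [Field L] [Algebra K L] [Algebra.IsAlgebraic K L]
variable (D : IterateDatum p K L)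
variable {d : ℕ} [NeZero d] (n : ZMod d → ℕ)

/-- The semilinear action `g(1 ⊗ eᵢ) = aᵢ(g) (1 ⊗ eᵢ)` attached to a cocycle `a`. -/
def diagonalAction (a : (L ≃ₐ[K] L) → ZMod d → RR p K L)
    (hmul : ∀ g h i, a (g * h) i = a g i * galR p K L g (a h i)) (hone : ∀ i, a 1 i = 1) :
    (L ≃ₐ[K] L) →* AddMonoid.End (PhiTensor D n) where
  toFun g :=
    { toFun := fun y => (coord D n).symm fun i => a g i * galR p K L g (coord D n y i)
      map_zero' := by
        rw [AddEquiv.symm_apply_eq]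
        funext i
        simp
      map_add' := fun y z => by
        rw [AddEquiv.symm_apply_eq]
        funext i
        simp [mul_add] }
  map_one' := by
    ext1 y
    change (coord D n).symm _ = y
    rw [AddEquiv.symm_apply_eq]
    funext i
    rw [hone, one_mul, galR_one]
  map_mul' g h := by
    ext1 y
    change (coord D n).symm _ = (coord D n).symm fun i => a g i * galR p K L g (coord D n
      ((coord D n).symm fun i => a h i * galR p K L h (coord D n y i)) i)
    rw [AddEquiv.apply_symm_apply]
    congr 1
    funext i
    rw [hmul, map_mul, galR_mul, mul_assoc]

theorem coord_diagonalAction (a : (L ≃ₐ[K] L) → ZMod d → RR p K L)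
    (hmul : ∀ g h i, a (g * h) i = a g i * galR p K L g (a h i)) (hone : ∀ i, a 1 i = 1)
    (g : L ≃ₐ[K] L) (y : PhiTensor D n) (i : ZMod d) :
    coord D n (diagonalAction D n a hmul hone g y) i = a g i * galR p K L g (coord D n y i) :=
  congrFun ((coord D n).apply_symm_apply _) i

/-- The matrix of `g` in the basis `1 ⊗ eᵢ` intertwines the matrices of `φ`. -/
theorem IsKisinAction.coord_intertwining {ρ : (L ≃ₐ[K] L) →* AddMonoid.End (PhiTensor D n)}
    (hρ : IsKisinAction D n ρ) (g : L ≃ₐ[K] L) (i j : ZMod d) :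
    galR p K L g (D.πR ^ p) ^ n i * coord D n (ρ g (1 ⊗ₜ SimpleKisin.e K n (i + 1))) (j + 1)
      = coord D n (ρ g (1 ⊗ₜ SimpleKisin.e K n i)) j ^ p * (D.πR ^ p) ^ n j := by
  have h1 : phiTensor D n (1 ⊗ₜ SimpleKisin.e K n i)
      = algebraMap (SS p K) (WPhi D) (X ^ n i) • (1 ⊗ₜ SimpleKisin.e K n (i + 1)) := by
    rw [phiTensor_tmul, map_one, SimpleKisin.phi_e, algebraMap_smul, tmul_smul]
  have h2 := congrArg (fun y => coord D n y (j + 1)) (hρ.comm g (1 ⊗ₜ SimpleKisin.e K n i))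
  simp only [h1, hρ.semilinear, coord_smul, coord_phiTensor] at h2
  rw [WPhi.red_gal, ← D.evalPow_redS, map_pow, redS, PowerSeries.map_X, map_pow, D.evalPow_X,
    map_pow] at h2
  rw [h2, mul_comm]

variable (hf : ∀ i ∈ Finset.Icc 1 (p - 1), ‖D.f.coeff i‖ < (p : ℝ)⁻¹)
include hf

theorem exists_isKisinAction :
    ∃ ρ : (L ≃ₐ[K] L) →* AddMonoid.End (PhiTensor D n), IsKisinAction D n ρ := by
  obtain ⟨a, ha1, ha, hmul, hone⟩ := D.exists_cocycle hf n
  have hρ := coord_diagonalAction D n a hmul (hone 1 (galR_one _))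
  refine ⟨diagonalAction D n a hmul (hone 1 (galR_one _)), fun g b y => ?_, fun g y => ?_,
    fun g hg s x => ?_, fun g x => ?_⟩
  · apply (coord D n).injective
    funext i
    rw [hρ, coord_smul, coord_smul, hρ, WPhi.red_gal, map_mul]
    ring
  · apply (coord D n).injective
    funext i
    obtain ⟨i, rfl⟩ : ∃ j, i = j + 1 := ⟨i - 1, (sub_add_cancel i 1).symm⟩
    rw [hρ, coord_phiTensor, coord_phiTensor, hρ, map_mul,
      map_pow (galR p K L g) (D.πR ^ p), map_pow (galR p K L g) (coord D n y i)]
    linear_combination galR p K L g (coord D n y i) ^ p * ha g i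
  · apply (coord D n).injective
    funext i
    have hg' := D.galR_πR_of_mem_galPi hg
    rw [hρ, hone g hg', one_mul, coord_tmul, map_mul, D.galR_red_ofS g hg', D.galR_evalPow g hg']
  · rw [mem_mIdeal_smul_top_iff]
    intro i
    obtain ⟨N, hN⟩ := exists_mem_mR_of_coeff_eq_zero (p := p) (K := K) (L := L)
      ((p : ℝ) ^ 2 / ((p : ℝ) - 1))
    obtain ⟨η, hη, hη1⟩ := D.exists_galR_πR_pow hf g
    have h1 := D.galR_evalPow_sub_mem g _ hN (by
      rw [hη, ← sub_one_mul]
      exact Ideal.mul_mem_right _ _ hη1) (x i)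
    have h2 := Ideal.add_mem _ (Ideal.mul_mem_right (galR p K L g (D.evalPow (x i))) _ (ha1 g i)) h1
    rw [map_sub, Pi.sub_apply, hρ, coord_tmul, map_one, one_mul]
    convert h2 using 1
    ring

theorem IsKisinAction.eq (hn : ∀ i, n i ≤ p - 1)
    {ρ ρ' : (L ≃ₐ[K] L) →* AddMonoid.End (PhiTensor D n)}
    (hρ : IsKisinAction D n ρ) (hρ' : IsKisinAction D n ρ') : ρ = ρ' := by
  have key : ∀ g i, ρ g (1 ⊗ₜ SimpleKisin.e K n i) = ρ' g (1 ⊗ₜ SimpleKisin.e K n i) := by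
    intro g i
    apply (coord D n).injective
    funext j
    rw [← sub_eq_zero]
    refine D.eq_zero_of_intertwining hf n hn g (fun i j =>
      coord D n (ρ g (1 ⊗ₜ SimpleKisin.e K n i)) j
        - coord D n (ρ' g (1 ⊗ₜ SimpleKisin.e K n i)) j) (fun i j => ?_) (fun i j => ?_) i j
    · have h1 := (mem_mIdeal_smul_top_iff D n _ _).1 (hρ.congr g (SimpleKisin.e K n i)) j
      have h2 := (mem_mIdeal_smul_top_iff D n _ _).1 (hρ'.congr g (SimpleKisin.e K n i)) j
      have h3 := Ideal.sub_mem _ h1 h2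
      rwa [map_sub, map_sub, Pi.sub_apply, Pi.sub_apply, sub_sub_sub_cancel_right] at h3
    · rw [mul_sub, hρ.coord_intertwining, hρ'.coord_intertwining, sub_pow_char, sub_mul]
  ext g y
  obtain ⟨c, rfl⟩ := PhiTensor.exists_eq_sum D n y
  rw [map_sum, map_sum]
  refine Finset.sum_congr rfl fun i _ => ?_
  have h1 : c i ⊗ₜ[SS p K] SimpleKisin.e K n i
      = c i • ((1 : WPhi D) ⊗ₜ[SS p K] SimpleKisin.e K n i) := by
    rw [smul_tmul', smul_eq_mul, mul_one]
  rw [h1, hρ.semilinear, hρ'.semilinear, key]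

end Action

end IterKisin
end

theorem mainTheorem11 (p : ℕ) [Fact p.Prime]
    -- `K` is a complete discrete valuation field of mixed characteristic `(0, p)` with perfect
    -- residue field
    (K : Type*) [NontriviallyNormedField K] [NormedAlgebra ℚ_[p] K] [IsUltrametricDist K]
    [CompleteSpace K] [IsDiscreteValuationRing (intK K)] [CharP (resK K) p]
    [PerfectField (resK K)]
    -- `L` is an algebraic closure of `K`
    (L : Type*) [Field L] [Algebra K L] [IsAlgClosure K L]
    -- `f(u) = u ^ p + a_{p-1} u ^ (p-1) + ⋯ + a_1 u` and `(π_n)`, with `v_p(a_i) > 1`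
    (D : IterateDatum p K L) (hf : ∀ i ∈ Finset.Icc 1 (p - 1), ‖D.f.coeff i‖ < (p : ℝ)⁻¹)
    -- `𝔫 = (n_i)` is a sequence with `0 ≤ n_i ≤ e r` and smallest period `d`
    (r d : ℕ) [NeZero d] (n : ZMod d → ℕ) (hn : ∀ i, n i ≤ ramIdx p K * r)
    (hper : ∀ c : ZMod d, (∀ i, n (i + c) = n i) → c = 0) :
    (∃ ρ : (L ≃ₐ[K] L) →* AddMonoid.End (PhiTensor D n), IsKisinAction D n ρ) ∧
    ((∀ i, n i ≤ min (ramIdx p K * r) (p - 1)) →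
      ∃! ρ : (L ≃ₐ[K] L) →* AddMonoid.End (PhiTensor D n), IsKisinAction D n ρ) := by
  have := IsAlgClosure.isAlgebraic (R := K) (K := L)
  refine ⟨exists_isKisinAction D n hf, fun hn' => ?_⟩
  obtain ⟨ρ, hρ⟩ := exists_isKisinAction D n hf
  exact ⟨ρ, hρ, fun ρ' hρ' => hρ'.eq D n hf (fun i => (hn' i).trans (min_le_right _ _)) hρ⟩
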